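/- Let $\mathbb F_q$ be the finite field with $q$ elements and let $K$ be an algebraic function field of one variable with exact constant field $\mathbb F_q$. Fix a place $\infty$ of $K$, let $\delta$ be its degree, let $A$ be the ring of all elements of $K$ that are integral at every place other than $\infty$, let $K_\infty$ be the completion of $K$ at $\infty$ with valuation ring $\mathcal O_\infty$, and let $G=GL_2(A)$. Let $\mathcal T$ be the Bruhat–Tits tree of $GL_2(K_\infty)$: its vertices are the homothety classes of $\mathcal O_\infty$-lattices of rank $2$ in $K_\infty\oplus K_\infty$, and two vertices are joined by an edge if they contain lattices $L_1$ and $L_2$ such that $L_2$ is a maximal proper $\mathcal O_\infty$-sublattice of $L_1$. The group $G$ acts on $\mathcal T$ through $G\subseteq GL_2(K_\infty)$. The quotient graph $G\backslash\mathcal T$ has as vertices the $G$-orbits of vertices and as edges the $G$-orbits of edges of $\mathcal T$. A vertex of $G\backslash\mathcal T$ is called isolated if exactly one edge of $G\backslash\mathcal T$ is attached to it. For a vertex $v$ of $\mathcal T$ let $G_v$ be its stabilizer in $G$ and $\widetilde v$ its image in $G\backslash\mathcal T$. **Theorem.** Let $v$ be a vertex of $\mathcal T$. Then $G_v$ is finite,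 and the following three conditions on $G_v$ are equivalent: (a) $q^2-1$ divides $|G_v|$; (b) $G_v$ contains a matrix whose eigenvalues (in an algebraic closure of $K$) are not in $\mathbb F_q$; (c) $G_v$ contains a cyclic subgroup of order $q^2-1$. Moreover, $\widetilde v$ is an isolated vertex of $G\backslash\mathcal T$ if and only if both of the following hold: (i) $\delta=1$; (ii) $G_v$ satisfies the equivalent conditions (a), (b), (c). -/

import Mathlib

noncomputable section

namespace DrinfeldModular

/-! ### Function fields and places -/

/-- `K` is an algebraic function field of one variable whose (exact) field of constants is `k`. -/
structure IsFunctionField (k K : Type*) [Field k] [Field K] [Algebra k K] : Prop where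
  /-- `K` is a finite extension of a rational function field `k(x)`. -/
  exists_finite : ∃ x : K, Transcendental k x ∧
    FiniteDimensional (IntermediateField.adjoin k {x}) K
  /-- `k` is algebraically closed in `K`. -/
  mem_range_of_isAlgebraic : ∀ y : K, IsAlgebraic k y → y ∈ (algebraMap k K).range

/-- A place of `K / k`, given by its valuation ring `k ⊆ 𝒪 ⊊ K`. -/
structure Place (k K : Type*) [Field k] [Field K] [Algebra k K] where
  /-- The valuation ring of the place. -/
  ring : ValuationSubring K
  algebraMap_mem : ∀ c : k, algebraMap k K c ∈ ring
  ne_top : ring ≠ ⊤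

namespace Place

variable {k K : Type*} [Field k] [Field K] [Algebra k K] (P : Place k K)

instance : Algebra k P.ring :=
  ((algebraMap k K).codRestrict P.ring.toSubring P.algebraMap_mem).toAlgebra

/-- The degree `δ` of a place: the degree over `k` of its residue field. -/
def degree : ℕ := Module.finrank k (IsLocalRing.ResidueField P.ring)

/-- The ring `A` of all elements of `K` that are integral outside the place `P`. -/
def integralOutside : Subring K :=
  ⨅ Q : {Q : Place k K // Q ≠ P}, Q.1.ring.toSubring

/-- The completion `K_∞` of `K` at the place. -/
abbrev Completion : Type _ := P.ring.valuation.Completion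

/-- The valuation ring `𝒪_∞` of `K_∞`. -/
abbrev completionRing : ValuationSubring P.Completion :=
  (Valued.v : Valuation P.Completion _).valuationSubring

/-- The group `G = GL₂(A)`. -/
abbrev modularGroup : Type _ := Matrix.GeneralLinearGroup (Fin 2) P.integralOutside

/-- The embedding `K → K_∞`. -/
def toCompletion : K →+* P.Completion :=
  (UniformSpace.Completion.coeRingHom : WithVal P.ring.valuation →+* P.Completion).comp
    (WithVal.equiv P.ring.valuation).symm.toRingHom

/-- The embedding `GL₂(A) → GL₂(K_∞)`. -/
def modularGroupToGL : P.modularGroup →* Matrix.GeneralLinearGroup (Fin 2) P.Completion :=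
  Matrix.GeneralLinearGroup.map (P.toCompletion.comp P.integralOutside.subtype)

end Place

/-! ### The Bruhat–Tits tree -/

section Tree

variable (R F : Type*) [CommRing R] [Field F] [Algebra R F]

/-- The `R`-lattices of rank two in `F ⊕ F`. -/
abbrev Lattice : Type _ := {L : Submodule R (Fin 2 → F) // L.IsLattice F}

variable {R F}

/-- The image `g L` of a lattice `L` under `g ∈ GL₂(F)`. -/
def Lattice.map (g : Matrix.GeneralLinearGroup (Fin 2) F) (L : Lattice R F) : Lattice R F :=
  ⟨L.1.map ((Matrix.mulVecLin g.1).restrictScalars R), by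
    have hL := L.2
    refine ⟨hL.fg.map _, ?_⟩
    rw [Submodule.map_coe, LinearMap.coe_restrictScalars, Submodule.span_image, hL.span_eq_top,
      Submodule.map_top, LinearMap.range_eq_top]
    intro y
    exact ⟨(g⁻¹).1.mulVec y, by
      rw [Matrix.mulVecLin_apply, Matrix.mulVec_mulVec, ← Units.val_mul, mul_inv_cancel,
        Units.val_one, Matrix.one_mulVec]⟩⟩

instance : MulAction (Matrix.GeneralLinearGroup (Fin 2) F) (Lattice R F) where
  smul := Lattice.map
  one_smul L := by
    apply Subtype.ext
    ext x
    simp [HSMul.hSMul, Lattice.map]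
  mul_smul g h L := by
    apply Subtype.ext
    change L.1.map _ = (L.1.map _).map _
    rw [← Submodule.map_comp]
    congr 1
    ext1 x
    simp

theorem Lattice.smul_val (g : Matrix.GeneralLinearGroup (Fin 2) F) (L : Lattice R F) :
    (g • L).1 = L.1.map ((Matrix.mulVecLin g.1).restrictScalars R) := rfl

/-- The scalar matrix with entry `c`. -/
def scalarGL (c : Fˣ) : Matrix.GeneralLinearGroup (Fin 2) F :=
  Units.map (Matrix.scalar (Fin 2) : F →+* Matrix (Fin 2) (Fin 2) F).toMonoidHom c

theorem scalarGL_mul_comm (c : Fˣ) (g : Matrix.GeneralLinearGroup (Fin 2) F) :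
    g * scalarGL c = scalarGL c * g :=
  Units.ext ((Matrix.scalar_commute (c : F) (fun _ => Commute.all _ _) g.1).eq.symm)

theorem scalarGL_mul (c d : Fˣ) : scalarGL (c * d) = scalarGL c * scalarGL d := map_mul _ _ _

theorem scalarGL_one : scalarGL (1 : Fˣ) = 1 := map_one _

variable (R F)

/-- Two lattices `L`, `L'` are homothetic if `L' = c L` for some `c ∈ Fˣ`. -/
def homothety : Setoid (Lattice R F) where
  r L L' := ∃ c : Fˣ, L' = scalarGL c • L
  iseqv :=
    { refl := fun L => ⟨1, by rw [scalarGL_one, one_smul]⟩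
      symm := by
        rintro L _ ⟨c, rfl⟩
        exact ⟨c⁻¹, by rw [smul_smul, ← scalarGL_mul, inv_mul_cancel, scalarGL_one, one_smul]⟩
      trans := by
        rintro L _ _ ⟨c, rfl⟩ ⟨d, rfl⟩
        exact ⟨d * c, by rw [smul_smul, scalarGL_mul]⟩ }

/-- The vertices of the tree: homothety classes of lattices. -/
def Vertex : Type _ := Quotient (homothety R F)

variable {R F}

/-- The homothety class of a lattice. -/
def Vertex.mk (L : Lattice R F) : Vertex R F := Quotient.mk (homothety R F) L

instance : MulAction (Matrix.GeneralLinearGroup (Fin 2) F) (Vertex R F) where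
  smul g := Quotient.map (g • ·) (by
    rintro L _ ⟨c, rfl⟩
    exact ⟨c, by rw [smul_smul, smul_smul, scalarGL_mul_comm]⟩)
  one_smul := by
    rintro ⟨L⟩
    exact congrArg Vertex.mk (one_smul _ L)
  mul_smul g h := by
    rintro ⟨L⟩
    exact congrArg Vertex.mk (mul_smul g h L)

theorem Vertex.smul_mk (g : Matrix.GeneralLinearGroup (Fin 2) F) (L : Lattice R F) :
    g • Vertex.mk L = Vertex.mk (g • L) := rfl

variable (R F)

/-- The Bruhat–Tits tree: two distinct vertices are joined by an edge if they contain lattices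
`L₁`, `L₂` such that one of them is a maximal proper `R`-submodule of the other (every submodule
between two lattices over a noetherian ring is a lattice). -/
def tree : SimpleGraph (Vertex R F) :=
  SimpleGraph.fromRel fun v w =>
    ∃ L₁ L₂ : Lattice R F, Vertex.mk L₁ = v ∧ Vertex.mk L₂ = w ∧ L₂.1 ⋖ L₁.1

end Tree

/-! ### Quotient graphs -/

section QuotientGraph

variable (G : Type*) {V : Type*} [Group G] [MulAction G V]

/-- The orbit of the unordered pair `{v, w}` under `G`. -/
def edgeOrbit (v w : V) : Set (Sym2 V) := Set.range fun g : G => s(g • v, g • w)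

theorem mk_eq_or_of_edgeOrbit_eq {v w v' w' : V} (h : edgeOrbit G v w = edgeOrbit G v' w') :
    (Quotient.mk (MulAction.orbitRel G V) v = Quotient.mk _ v') ∨
    (Quotient.mk (MulAction.orbitRel G V) v = Quotient.mk _ w') := by
  have : s(v, w) ∈ edgeOrbit G v' w' := h ▸ ⟨1, by simp⟩
  obtain ⟨g, hg⟩ := this
  rcases Sym2.eq_iff.1 hg with ⟨h1, -⟩ | ⟨-, h2⟩
  · exact Or.inl (Quotient.sound ⟨g, h1⟩)
  · exact Or.inr (Quotient.sound ⟨g, h2⟩)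

/-- The quotient `G \ T` of a graph `T` by a group acting on it: its vertices are the `G`-orbits
of vertices of `T`, its edges are the `G`-orbits of edges of `T`. It is a multigraph. -/
def quotientGraph (T : SimpleGraph V) :
    Graph (MulAction.orbitRel.Quotient G V) (Set (Sym2 V)) where
  vertexSet := Set.univ
  IsLink E x y := ∃ v w : V, T.Adj v w ∧ E = edgeOrbit G v w ∧
    Quotient.mk _ v = x ∧ Quotient.mk _ w = y
  isLink_symm := by
    refine fun E _ => ⟨?_⟩
    rintro _ _ ⟨v, w, hvw, rfl, rfl, rfl⟩
    refine ⟨w, v, hvw.symm, ?_, rfl, rfl⟩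
    simp only [edgeOrbit]
    congr 1
    ext1 g
    exact Sym2.eq_swap
  eq_or_eq_of_isLink_of_isLink := by
    rintro _ _ _ _ _ ⟨v, w, -, rfl, rfl, rfl⟩ ⟨v', w', -, hE, rfl, rfl⟩
    exact mk_eq_or_of_edgeOrbit_eq G hE
  left_mem_of_isLink := fun _ _ _ _ => Set.mem_univ _

/-- A vertex of a multigraph is isolated if exactly one edge is attached to it. -/
def IsIsolated {α β : Type*} (Q : Graph α β) (x : α) : Prop := ∃! e, Q.Inc e x

end QuotientGraph

/-! ### The action of `GL₂(A)` on the Bruhat–Tits tree of `GL₂(K_∞)` -/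

namespace Place

variable {k K : Type*} [Field k] [Field K] [Algebra k K] (P : Place k K)

/-- The vertices of the Bruhat–Tits tree of `GL₂(K_∞)`. -/
abbrev TreeVertex : Type _ := Vertex P.completionRing P.Completion

instance : MulAction P.modularGroup P.TreeVertex := MulAction.compHom _ P.modularGroupToGL

/-- The quotient graph `G \ T`. -/
def quotientTree :
    Graph (MulAction.orbitRel.Quotient P.modularGroup P.TreeVertex) (Set (Sym2 P.TreeVertex)) :=
  quotientGraph P.modularGroup (tree P.completionRing P.Completion)

/-- The characteristic polynomial, over `K`, of a matrix in `GL₂(A)`. -/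
def charpoly (M : P.modularGroup) : Polynomial K :=
  (M.1.map P.integralOutside.subtype).charpoly

end Place

end DrinfeldModular

end

noncomputable section

namespace DrinfeldModular

open Matrix Polynomial

/-! ### Finite algebras of two by two matrices -/

section MatrixIdentities

variable {F : Type*} [CommRing F]

/-! Write $v$ as the class of a lattice $L = B\mathcal O_\infty^2$, and let $R$ (`endAlgebra`) be
the $k$-algebra of matrices over $A$ that preserve $L$. The entries of such matrices have bounded
poles at $\infty$, and only finitely many elements of $A$ do, so $R$ is finite. Units of $A$ are
constants, so elements of $G$ have determinant of valuation zero. Hence an element fixing the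
homothety class of $L$ fixes $L$ itself, which gives $G_v \cong R^\times$ (`stabilizerEquiv`). For
the same reason no element of $G$ moves $v$ to a neighbour. The edges at $\widetilde v$ are
therefore the $G_v$-orbits of neighbours of $v$, that is, of lines in the reduction $L/\pi
L\cong\kappa^2$, and $\widetilde v$ is isolated exactly when $R^\times$ is transitive on these lines
(`isIsolated_iff_isTransitiveOnLines`).

The rest is algebra of a finite $R\subseteq M_2(K)$. Traces, determinants and eigenvalues in $K$ of
its elements are algebraic over $k$, hence lie in $k$. If no element is nonsplit, that is, free of
eigenvalues in $k$, then $R$ has a common eigenvector. In that case $R^\times$ maps to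
$k^\times\times k^\times$ by (eigenvalue, determinant) with kernel a $p$-group, and $q+1$ cannot
divide $p^n(q-1)$; this gives (a) ⇒ (b). A nonsplit $M$ generates a field $k[M]$ with $q^2$
elements, whose cyclic unit group gives (c). Lagrange gives (a).

For isolation, `exists_card_range_mulVec_le` finds $w\ne0$ in $K^2$ with $|Rw|\le q^2$. Scaled to a
primitive vector of $L$, it reduces to $a\neq 0$ in $\kappa^2$ with at most $q^2-1$ nonzero vectors
in $Ra$. If the lines through these exhaust $\kappa^2$, then $|\kappa|<q^2$, so $\delta=1$, and the
orbit of $a$ consists of all $q^2-1$ nonzero vectors of $\kappa^2$. Conversely, if $\delta=1$ and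
$M$ is nonsplit, $k[M]^\times$ is already transitive on nonzero vectors of $\kappa^2$. -/

theorem mul_self_eq_trace_smul_sub (M : Matrix (Fin 2) (Fin 2) F) :
    M * M = M.trace • M - M.det • 1 := by
  ext i j
  fin_cases i <;> fin_cases j <;>
    simp [Matrix.mul_apply, Fin.sum_univ_two, trace_fin_two, det_fin_two] <;> ring

/-- Over a field, a singular $N$ has the form $uv^T$, so $NMN = u(v^TMu)v^T$. The coordinate proof
works over any commutative ring. -/
theorem mul_mul_eq_trace_smul {N : Matrix (Fin 2) (Fin 2) F} (hN : N.det = 0)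
    (M : Matrix (Fin 2) (Fin 2) F) : N * M * N = (N * M).trace • N := by
  rw [det_fin_two] at hN
  ext i j
  fin_cases i <;> fin_cases j <;>
    simp [Matrix.mul_apply, Fin.sum_univ_two, trace_fin_two]
  · linear_combination (-M 1 1) * hN
  · linear_combination (M 0 1) * hN
  · linear_combination (M 1 0) * hN
  · linear_combination (-M 0 0) * hN

theorem det_add_smul_one (M : Matrix (Fin 2) (Fin 2) F) (c : F) :
    (M + c • (1 : Matrix (Fin 2) (Fin 2) F)).det = c ^ 2 + c * M.trace + M.det := by
  simp [trace_fin_two, det_fin_two]; ring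

theorem det_add_smul (M N : Matrix (Fin 2) (Fin 2) F) (hN : N.det = 0) (hN' : N.trace = 0)
    (c : F) : (M + c • N).det = M.det - c * (N * M).trace := by
  simp only [trace_fin_two, det_fin_two, Matrix.mul_apply, Fin.sum_univ_two, Matrix.add_apply,
    Matrix.smul_apply, smul_eq_mul] at *
  linear_combination c ^ 2 * hN + c * (M 0 0 + M 1 1) * hN'

end MatrixIdentities

section FieldMatrix

variable {F : Type*} [Field F]

theorem exists_eq_smul_of_mulVec_eq_zero {N : Matrix (Fin 2) (Fin 2) F} (hN : N ≠ 0)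
    {u x : Fin 2 → F} (hu : u ≠ 0) (hNu : N *ᵥ u = 0) (hNx : N *ᵥ x = 0) :
    ∃ c : F, x = c • u := by
  have key : x 0 * u 1 = x 1 * u 0 := by
    by_contra h
    apply hN
    ext i j
    have h1 := congrFun hNu i
    have h2 := congrFun hNx i
    simp only [Matrix.mulVec, dotProduct, Fin.sum_univ_two, Pi.zero_apply] at h1 h2
    have h' : x 0 * u 1 - x 1 * u 0 ≠ 0 := sub_ne_zero.2 h
    fin_cases j
    · refine (mul_eq_zero.1 (?_ : N i 0 * (x 0 * u 1 - x 1 * u 0) = 0)).resolve_right h'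
      linear_combination u 1 * h2 - x 1 * h1
    · refine (mul_eq_zero.1 (?_ : N i 1 * (x 0 * u 1 - x 1 * u 0) = 0)).resolve_right h'
      linear_combination x 0 * h1 - u 0 * h2
  by_cases h0 : u 0 = 0
  · have h1 : u 1 ≠ 0 := fun h1 => hu (by ext i; fin_cases i <;> simp [h0, h1])
    refine ⟨x 1 / u 1, ?_⟩
    ext i
    fin_cases i
    · have : x 0 = 0 := by simpa [h0, h1] using key
      simp [h0, this]
    · simp [h1]
  · refine ⟨x 0 / u 0, ?_⟩
    ext i
    fin_cases i
    · simp [h0]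
    · simp only [Fin.mk_one, Pi.smul_apply, smul_eq_mul]
      field_simp
      linear_combination -key

theorem exists_mulVec_ne_zero {N : Matrix (Fin 2) (Fin 2) F} (hN : N ≠ 0) :
    ∃ a : Fin 2 → F, N *ᵥ a ≠ 0 := by
  by_contra! h
  exact hN (Matrix.ext_of_mulVec_single fun i => by rw [h, zero_mulVec])

end FieldMatrix

section

variable {k K : Type*} [Field k] [Field K] [Algebra k K]

theorem isAlgebraic_of_pow_eq_pow {x : K} {a b : ℕ} (hab : a ≠ b) (h : x ^ a = x ^ b) :
    IsAlgebraic k x := by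
  refine ⟨X ^ a - X ^ b, ?_, by simp [h]⟩
  intro h0
  have := congrArg (fun p => Polynomial.coeff p a) h0
  simp [Polynomial.coeff_X_pow, hab] at this

variable (R : Subalgebra k (Matrix (Fin 2) (Fin 2) K))

/-- The matrices in `R` have a common eigenvector. -/
def HasCommonEigenvector : Prop :=
  ∃ w : Fin 2 → K, w ≠ 0 ∧ ∀ M ∈ R, ∃ c : K, M *ᵥ w = c • w

/-- Some matrix in `R` has no eigenvalue in `k`. -/
def HasNonsplit : Prop :=
  ∃ M ∈ R, ∀ c : k, (M + algebraMap k K c • (1 : Matrix (Fin 2) (Fin 2) K)).det ≠ 0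

variable {R}

theorem algebraMap_smul_mem {M : Matrix (Fin 2) (Fin 2) K} (hM : M ∈ R) (c : k) :
    algebraMap k K c • M ∈ R := by
  rw [algebraMap_smul]; exact R.smul_mem hM c

theorem smul_one_mem (c : k) : algebraMap k K c • (1 : Matrix (Fin 2) (Fin 2) K) ∈ R :=
  algebraMap_smul_mem R.one_mem c

variable (hk : ∀ y : K, IsAlgebraic k y → y ∈ (algebraMap k K).range)
include hk

/-- Two powers of $M$ coincide because $R$ is finite, so the determinant is a root of some $X^a-X^b$
and is algebraic over $k$. -/
theorem exists_det_eq [Finite R] {M : Matrix (Fin 2) (Fin 2) K} (hM : M ∈ R) :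
    ∃ d : k, algebraMap k K d = M.det := by
  obtain ⟨a, b, hab, h⟩ := Finite.exists_ne_map_eq_of_infinite fun n : ℕ => (⟨M, hM⟩ : R) ^ n
  refine hk _ (isAlgebraic_of_pow_eq_pow hab ?_)
  rw [← det_pow, ← det_pow]
  exact congrArg (fun N : R => N.1.det) h

/-- The trace is recovered from two determinants: $\det(M+1)=1+\operatorname{tr}M+\det M$. -/
theorem exists_trace_eq [Finite R] {M : Matrix (Fin 2) (Fin 2) K} (hM : M ∈ R) :
    ∃ t : k, algebraMap k K t = M.trace := by
  obtain ⟨d, hd⟩ := exists_det_eq hk hM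
  obtain ⟨e, he⟩ := exists_det_eq hk (R.add_mem hM (smul_one_mem (1 : k)))
  refine ⟨e - 1 - d, ?_⟩
  rw [map_sub, map_sub, he, hd, det_add_smul_one]
  simp only [map_one]
  ring

theorem exists_eigenvalue_eq [Finite R] {M : Matrix (Fin 2) (Fin 2) K} (hM : M ∈ R)
    {w : Fin 2 → K} (hw : w ≠ 0) {c : K} (hc : M *ᵥ w = c • w) :
    ∃ d : k, algebraMap k K d = c := by
  obtain ⟨a, b, hab, h⟩ := Finite.exists_ne_map_eq_of_infinite fun n : ℕ => (⟨M, hM⟩ : R) ^ n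
  have hp : ∀ n : ℕ, (M ^ n) *ᵥ w = c ^ n • w := by
    intro n
    induction n with
    | zero => simp
    | succ n ih => rw [pow_succ, ← mulVec_mulVec, hc, mulVec_smul, ih, smul_smul, pow_succ']
  refine hk _ (isAlgebraic_of_pow_eq_pow hab (smul_left_injective K hw ?_))
  have h2 : M ^ a = M ^ b := congrArg Subtype.val h
  simp only [← hp, h2]

/-- By Cayley–Hamilton the inverse is $d^{-1}(t-M)$ with $t,d\in k$, so it stays in $R$. -/
theorem mem_isUnit [Finite R] {M : Matrix (Fin 2) (Fin 2) K} (hM : M ∈ R) (hd : M.det ≠ 0) :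
    IsUnit (⟨M, hM⟩ : R) := by
  obtain ⟨d, hd'⟩ := exists_det_eq hk hM
  obtain ⟨t, ht⟩ := exists_trace_eq hk hM
  let N := algebraMap k K d⁻¹ • (algebraMap k K t • (1 : Matrix (Fin 2) (Fin 2) K) - M)
  have hN : N ∈ R := algebraMap_smul_mem (R.sub_mem (smul_one_mem t) hM) _
  have h1 : M * N = 1 := by
    simp only [N, mul_smul_comm, mul_sub, mul_one, mul_self_eq_trace_smul_sub, ht, map_inv₀, hd',
      sub_sub_cancel, smul_smul, inv_mul_cancel₀ hd, one_smul]
  have h2 : N * M = 1 := by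
    simp only [N, smul_mul_assoc, sub_mul, one_mul, mul_self_eq_trace_smul_sub, ht, map_inv₀, hd',
      sub_sub_cancel, smul_smul, inv_mul_cancel₀ hd, one_smul]
  exact ⟨⟨⟨M, hM⟩, ⟨N, hN⟩, Subtype.ext h1, Subtype.ext h2⟩, rfl⟩

omit hk in
-- For a nonzero nilpotent $N$ the image equals the kernel, a line. The trace condition gives
-- $NMN=0$, so each $M$ maps the image of $N$ into its kernel, which is the same line.
theorem hasCommonEigenvector_of_trace_eq_zero {N : Matrix (Fin 2) (Fin 2) K}
    (hN0 : N ≠ 0) (hNd : N.det = 0) (hNt : N.trace = 0)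
    (h : ∀ M ∈ R, (N * M).trace = 0) : HasCommonEigenvector R := by
  obtain ⟨a, ha⟩ := exists_mulVec_ne_zero hN0
  refine ⟨N *ᵥ a, ha, fun M hM => exists_eq_smul_of_mulVec_eq_zero hN0 ha ?_ ?_⟩
  · rw [mulVec_mulVec, mul_self_eq_trace_smul_sub, hNd, hNt]; simp
  · rw [mulVec_mulVec, mulVec_mulVec, mul_mul_eq_trace_smul hNd, h M hM]; simp

omit hk in
-- This yields a polynomial $X^2-tX+d$ without roots in $k$. The map $a\mapsto a(t-a)$ takes equal
-- values at $0,t$, or at $1,-1$ when $t=0$, so on the finite set $k$ it is not surjective.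
theorem exists_ne_mul_sub [Finite k] {t : k} (h : t ≠ 0 ∨ (2 : k) ≠ 0) :
    ∃ d : k, ∀ a : k, a * (t - a) ≠ d := by
  have : ¬ Function.Injective fun a : k => a * (t - a) := by
    intro hi
    rcases eq_or_ne t 0 with rfl | ht
    · have h2 : (2 : k) ≠ 0 := h.resolve_left (fun h => h rfl)
      have := @hi 1 (-1) (by simp)
      exact h2 (by linear_combination this)
    · exact ht (@hi 0 t (by simp)).symm
  rw [Finite.injective_iff_surjective] at this
  simpa [Function.Surjective] using this

/-- Along the pencil $M+cN$ the trace is fixed, while the determinant is a nonconstant affine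
function of $c$. So the characteristic polynomial can be made rootless over $k$. -/
theorem hasNonsplit_of_trace_ne_zero [Finite k] [Finite R] {N M : Matrix (Fin 2) (Fin 2) K}
    (hN : N ∈ R) (hM : M ∈ R) (hNd : N.det = 0) (hNt : N.trace = 0)
    (h : (N * M).trace ≠ 0) : HasNonsplit R := by
  obtain ⟨M', hM', h', ht'⟩ : ∃ M' ∈ R, (N * M').trace ≠ 0 ∧ (M'.trace ≠ 0 ∨ (2 : K) ≠ 0) := by
    -- Trace zero is fatal in characteristic 2. Replacing $M$ by $M+MN$ makes the trace
    -- $\operatorname{tr}(NM)\ne0$ and leaves $\operatorname{tr}(NM)$ itself unchanged.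
    by_cases ht : M.trace = 0
    · refine ⟨M + M * N, R.add_mem hM (R.mul_mem hM hN), ?_, Or.inl ?_⟩
      · rw [mul_add, ← mul_assoc, mul_mul_eq_trace_smul hNd, trace_add, trace_smul, hNt]
        simpa using h
      · rw [trace_add, ht, zero_add, trace_mul_comm]; exact h
    · exact ⟨M, hM, h, Or.inl ht⟩
  obtain ⟨c, hc⟩ := exists_trace_eq hk (R.mul_mem hN hM')
  obtain ⟨t, ht⟩ := exists_trace_eq hk hM'
  obtain ⟨e, he⟩ := exists_det_eq hk hM'
  have hinj := (algebraMap k K).injective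
  obtain ⟨d, hd⟩ := exists_ne_mul_sub (t := t) (by
    refine ht'.imp (fun h h0 => h ?_) (fun h h0 => h ?_)
    · rw [← ht, h0, map_zero]
    · rw [← map_ofNat (algebraMap k K) 2, h0, map_zero])
  have hc0 : c ≠ 0 := fun h0 => h' (by rw [← hc, h0, map_zero])
  -- The coefficient is chosen so that the determinant drops from $e$ to $d$.
  refine ⟨M' + algebraMap k K ((e - d) / c) • N, R.add_mem hM' (algebraMap_smul_mem hN _), ?_⟩
  intro a h0
  rw [det_add_smul_one, det_add_smul _ _ hNd hNt, trace_add, trace_smul, hNt, ← hc, ← ht, ← he] at h0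
  apply hd (-a)
  apply hinj
  rw [← sub_eq_zero, ← neg_eq_zero, ← h0, ← map_mul, div_mul_cancel₀ _ hc0]
  simp only [map_mul, map_sub, map_neg, smul_zero, add_zero]
  ring

/-- Without nilpotents, $N$ is a nonzero multiple of a rank one idempotent. For
$t=\operatorname{tr}N$, the element $(tM-NM)N$ is singular of trace zero, hence zero, so $tMN=NMN$
is a multiple of $N$ and the image of $N$ is stable under $M$. -/
theorem hasCommonEigenvector_of_idempotent [Finite R]
    (hR : ∀ N ∈ R, N.det = 0 → N.trace = 0 → N = 0) {N : Matrix (Fin 2) (Fin 2) K} (hN : N ∈ R)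
    (hN0 : N ≠ 0) (hNd : N.det = 0) : HasCommonEigenvector R := by
  obtain ⟨t, ht⟩ := exists_trace_eq hk hN
  have ht0 : N.trace ≠ 0 := fun h => hN0 (hR N hN hNd h)
  obtain ⟨a, ha⟩ := exists_mulVec_ne_zero hN0
  have hNN : N * N = N.trace • N := by rw [mul_self_eq_trace_smul_sub, hNd]; simp
  refine ⟨N *ᵥ a, ha, fun M hM => ⟨(N * M).trace / N.trace, ?_⟩⟩
  have h1 : (algebraMap k K t • M - N * M) * N = 0 := by
    have hmem : (algebraMap k K t • M - N * M) * N ∈ R :=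
      R.mul_mem (R.sub_mem (algebraMap_smul_mem hM t) (R.mul_mem hN hM)) hN
    refine hR _ hmem (by rw [det_mul, hNd, mul_zero]) ?_
    rw [trace_mul_comm, mul_sub, ← mul_assoc, hNN, ht]
    simp
  rw [sub_mul, sub_eq_zero, mul_mul_eq_trace_smul hNd, ht, smul_mul_assoc] at h1
  rw [mulVec_mulVec, div_eq_inv_mul, mul_smul, ← smul_mulVec, ← h1, smul_mulVec, smul_smul,
    inv_mul_cancel₀ ht0, one_smul]

/-- If $R$ has a nonzero nilpotent, the two trace lemmas decide. Otherwise either all elements are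
scalar, or a nonscalar $M$ with an eigenvalue in $k$ gives a nonzero singular $M+c$. -/
theorem hasCommonEigenvector_of_not_hasNonsplit [Finite k] [Finite R] (h : ¬ HasNonsplit R) :
    HasCommonEigenvector R := by
  by_cases hnil : ∀ N ∈ R, N.det = 0 → N.trace = 0 → N = 0
  · by_cases hs : ∀ M ∈ R, ∃ c : K, M = c • 1
    · refine ⟨fun _ => 1, fun h => one_ne_zero (congrFun h 0), fun M hM => ?_⟩
      obtain ⟨c, rfl⟩ := hs M hM
      exact ⟨c, by rw [smul_mulVec, one_mulVec]⟩
    · push Not at hs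
      obtain ⟨M, hM, hMs⟩ := hs
      simp only [HasNonsplit, not_exists, not_and, not_forall, not_not] at h
      obtain ⟨c, hc⟩ := h M hM
      refine hasCommonEigenvector_of_idempotent hk hnil (R.add_mem hM (smul_one_mem c)) ?_ hc
      intro h0
      apply hMs (-algebraMap k K c)
      rw [neg_smul]
      exact eq_neg_of_add_eq_zero_left h0
  · push Not at hnil
    obtain ⟨N, hN, hNd, hNt, hN0⟩ := hnil
    refine hasCommonEigenvector_of_trace_eq_zero hN0 hNd hNt fun M hM => ?_
    by_contra hM'
    exact h (hasNonsplit_of_trace_ne_zero hk hN hM hNd hNt hM')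

end
end DrinfeldModular
end

noncomputable section

namespace DrinfeldModular

open Matrix Polynomial

theorem det_zero_fin_two {F : Type*} [CommRing F] : (0 : Matrix (Fin 2) (Fin 2) F).det = 0 :=
  det_zero

/-! ### Unit groups of finite matrix algebras -/

section

variable {k K : Type*} [Field k] [Field K] [Algebra k K]
  {R : Subalgebra k (Matrix (Fin 2) (Fin 2) K)}

/-- Multiplicativity of the determinant makes $R$ a finite domain, hence a field by Wedderburn. -/
theorem isCyclic_units_and_card [Finite R] (hR : ∀ N ∈ R, N.det = 0 → N = 0) :
    IsCyclic Rˣ ∧ Nat.card Rˣ = Nat.card R - 1 ∧ ∀ M N : R, M * N = N * M := by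
  have : NoZeroDivisors R := ⟨fun {M N} h => by
    have h' := congrArg (fun X : R => X.1.det) h
    simp only [Subalgebra.coe_mul, det_mul, Subalgebra.coe_zero, det_zero_fin_two] at h'
    exact (mul_eq_zero.1 h').imp (fun h => Subtype.ext (hR _ M.2 h)) (fun h => Subtype.ext (hR _ N.2 h))⟩
  have : IsDomain R := NoZeroDivisors.to_isDomain R
  have hF := Finite.isDomain_to_isField R
  let _ : Field R := hF.toField
  exact ⟨inferInstance, Nat.card_units R, hF.mul_comm⟩

theorem exists_pow_eq {M : Matrix (Fin 2) (Fin 2) K} {t d : k} (ht : algebraMap k K t = M.trace)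
    (hd : algebraMap k K d = M.det) (n : ℕ) :
    ∃ a b : k, M ^ n = algebraMap k K a • (1 : Matrix (Fin 2) (Fin 2) K) + algebraMap k K b • M := by
  induction n with
  | zero => exact ⟨1, 0, by simp⟩
  | succ n ih =>
    obtain ⟨a, b, h⟩ := ih
    refine ⟨-(b * d), a + b * t, ?_⟩
    rw [pow_succ, h, add_mul, smul_mul_assoc, smul_mul_assoc, one_mul, mul_self_eq_trace_smul_sub,
      ← ht, ← hd]
    simp only [map_neg, map_add, map_mul, smul_sub, smul_smul, add_smul, neg_smul]
    abel

variable (hk : ∀ y : K, IsAlgebraic k y → y ∈ (algebraMap k K).range)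
include hk

/-- A generator $g$ of the cyclic group $R^\times$ satisfies a quadratic equation over $k$, so every
element of $R$ lies in $k+kg$. -/
theorem card_le_of_det_eq_zero [Finite k] [Finite R] (hR : ∀ N ∈ R, N.det = 0 → N = 0) :
    Nat.card R ≤ Nat.card k ^ 2 := by
  obtain ⟨hc, -, -⟩ := isCyclic_units_and_card hR
  obtain ⟨g, hg⟩ := hc.exists_monoid_generator
  obtain ⟨t, ht⟩ := exists_trace_eq hk g.1.2
  obtain ⟨d, hd⟩ := exists_det_eq hk g.1.2
  let f : k × k → R := fun ab => ⟨algebraMap k K ab.1 • 1 + algebraMap k K ab.2 • g.1.1,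
    R.add_mem (smul_one_mem _) (algebraMap_smul_mem g.1.2 _)⟩
  have hf : Function.Surjective f := by
    intro M
    by_cases hM : M = 0
    · exact ⟨(0, 0), Subtype.ext (by simp [f, hM])⟩
    · obtain ⟨u, hu⟩ := mem_isUnit hk M.2 fun h => hM (Subtype.ext (hR _ M.2 h))
      obtain ⟨n, rfl⟩ := hg u
      obtain ⟨a, b, h⟩ := exists_pow_eq ht hd n
      exact ⟨(a, b), Subtype.ext (h.symm.trans (congrArg Subtype.val hu))⟩
  calc Nat.card R ≤ Nat.card (k × k) := Nat.card_le_card_of_surjective f hf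
    _ = Nat.card k ^ 2 := by rw [Nat.card_prod, sq]

/-- There is a nonzero vector in `K²` whose orbit under `R` has at most `|k|²` elements. -/
theorem exists_card_range_mulVec_le [Finite k] [Finite R] :
    ∃ w : Fin 2 → K, w ≠ 0 ∧
      Nat.card (Set.range fun M : R => M.1 *ᵥ w) ≤ Nat.card k ^ 2 := by
  by_cases hce : HasCommonEigenvector R
  · obtain ⟨w, hw, h⟩ := hce
    refine ⟨w, hw, ?_⟩
    have hsub : (Set.range fun M : R => M.1 *ᵥ w) ⊆
        Set.range fun c : k => algebraMap k K c • w := by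
      rintro _ ⟨M, rfl⟩
      obtain ⟨c, hc⟩ := h M.1 M.2
      obtain ⟨d, rfl⟩ := exists_eigenvalue_eq hk M.2 hw hc
      exact ⟨d, hc.symm⟩
    calc _ ≤ Nat.card (Set.range fun c : k => algebraMap k K c • w) :=
          Nat.card_mono (Set.finite_range _) hsub
      _ ≤ Nat.card k := Finite.card_range_le _
      _ ≤ Nat.card k ^ 2 := Nat.le_self_pow two_ne_zero _
  by_cases hnil : ∀ N ∈ R, N.det = 0 → N.trace = 0 → N = 0
  · refine ⟨fun _ => 1, fun h => one_ne_zero (congrFun h 0), (Finite.card_range_le _).trans ?_⟩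
    refine card_le_of_det_eq_zero hk fun N hN hNd => ?_
    by_contra hN0
    exact hce (hasCommonEigenvector_of_idempotent hk hnil hN hN0 hNd)
  · push Not at hnil
    obtain ⟨N, hN, hNd, hNt, hN0⟩ := hnil
    -- Take $w=Na$, spanning $\ker N$. The vector $rw$ is determined by
    -- $N(rw)=\operatorname{tr}(Nr)w$ and $NM(rw)=\operatorname{tr}(NMr)w$: a difference killed by
    -- $N$ is some $cw$, and $NM(cw)=c\operatorname{tr}(NM)w$. So two elements of $k$ encode $rw$.
    obtain ⟨M, hM, hNM⟩ : ∃ M ∈ R, (N * M).trace ≠ 0 := by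
      by_contra! h
      exact hce (hasCommonEigenvector_of_trace_eq_zero hN0 hNd hNt h)
    obtain ⟨a, ha⟩ := exists_mulVec_ne_zero hN0
    refine ⟨N *ᵥ a, ha, ?_⟩
    have hNr : ∀ r, N *ᵥ (r *ᵥ (N *ᵥ a)) = (N * r).trace • (N *ᵥ a) := fun r => by
      rw [mulVec_mulVec, mulVec_mulVec, mul_mul_eq_trace_smul hNd, smul_mulVec]
    choose τ hτ using fun r : R => exists_trace_eq hk (R.mul_mem hN r.2)
    choose σ hσ using fun r : R => exists_trace_eq hk (R.mul_mem hN (R.mul_mem hM r.2))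
    have hinj : ∀ r s : R, τ r = τ s → σ r = σ s → r.1 *ᵥ (N *ᵥ a) = s.1 *ᵥ (N *ᵥ a) := by
      intro r s h1 h2
      have h1' : N *ᵥ ((r.1 - s.1) *ᵥ (N *ᵥ a)) = 0 := by
        rw [hNr, mul_sub, trace_sub, ← hτ, ← hτ, h1, sub_self, zero_smul]
      have h2' : N *ᵥ (M *ᵥ ((r.1 - s.1) *ᵥ (N *ᵥ a))) = 0 := by
        rw [mulVec_mulVec _ M, hNr, mul_sub, mul_sub, trace_sub, ← hσ, ← hσ, h2, sub_self,
          zero_smul]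
      have hNN : N *ᵥ (N *ᵥ a) = 0 := by
        rw [mulVec_mulVec, mul_self_eq_trace_smul_sub, hNd, hNt]; simp
      obtain ⟨c, hc⟩ := exists_eq_smul_of_mulVec_eq_zero hN0 ha hNN h1'
      rw [hc, mulVec_smul, mulVec_smul, hNr, smul_smul, smul_eq_zero] at h2'
      have hc0 : c = 0 := (mul_eq_zero.1 (h2'.resolve_right ha)).resolve_right hNM
      rw [hc0, zero_smul, sub_mulVec] at hc
      exact sub_eq_zero.1 hc
    let f : (Set.range fun M : R => M.1 *ᵥ (N *ᵥ a)) → k × k :=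
      fun y => (τ y.2.choose, σ y.2.choose)
    have hf : Function.Injective f := by
      intro y z hyz
      have := hinj _ _ (congrArg Prod.fst hyz) (congrArg Prod.snd hyz)
      rw [Subtype.ext_iff, ← y.2.choose_spec, ← z.2.choose_spec]
      exact this
    calc _ ≤ Nat.card (k × k) := Nat.card_le_card_of_injective f hf
      _ = Nat.card k ^ 2 := by rw [Nat.card_prod, sq]

/-- The pair (eigenvalue on $w$, determinant) sends $R^\times$ into $k^\times\times k^\times$ with
kernel a $p$-group, so $|R^\times|$ divides $p^n(q-1)^2$. Since $q+1$ is prime to $p$, divisibility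
would force $q+1\mid q-1$. -/
theorem not_dvd_card_units_of_hasCommonEigenvector [Finite k] [Finite R]
    (h : HasCommonEigenvector R) : ¬ Nat.card k ^ 2 - 1 ∣ Nat.card Rˣ := by
  obtain ⟨w, hw, h⟩ := h
  choose! χ hχ using h
  have hχ' : ∀ {M} (_ : M ∈ R) {c : K}, M *ᵥ w = c • w → χ M = c := fun hM c hc =>
    smul_left_injective K hw ((hχ _ hM).symm.trans hc)
  let χ' : R →* K :=
    { toFun := fun M => χ M
      map_one' := hχ' R.one_mem (by simp)
      map_mul' := fun M N => hχ' (R.mul_mem M.2 N.2) (by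
        rw [← mulVec_mulVec, hχ _ N.2, mulVec_smul, hχ _ M.2, smul_smul, mul_comm]) }
  let δ : R →* K := detMonoidHom.comp (R.val : R →* Matrix (Fin 2) (Fin 2) K)
  let f : Rˣ →* Kˣ × Kˣ := (Units.map χ').prod (Units.map δ)
  let H : Subgroup Kˣ := (Units.map (algebraMap k K : k →* K)).range
  have hH : Nat.card H = Nat.card k - 1 := by
    rw [← Nat.card_units]
    exact (Nat.card_congr (MonoidHom.ofInjective
      (Units.map_injective (algebraMap k K).injective)).toEquiv).symm
  have hmemH : ∀ u : Kˣ, (∃ d : k, algebraMap k K d = u) → u ∈ H := by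
    rintro u ⟨d, hd⟩
    have hd0 : d ≠ 0 := fun h => u.ne_zero (by rw [← hd, h, map_zero])
    exact ⟨Units.mk0 d hd0, Units.ext hd⟩
  have hrange : f.range ≤ H.prod H := by
    rintro _ ⟨u, rfl⟩
    exact ⟨hmemH _ (exists_eigenvalue_eq hk u.1.2 hw (hχ _ u.1.2)),
      hmemH _ (exists_det_eq hk u.1.2)⟩
  have hcard : Nat.card f.range ∣ (Nat.card k - 1) * (Nat.card k - 1) := by
    have := Subgroup.card_dvd_of_le hrange
    rwa [Nat.card_congr (Subgroup.prodEquiv H H).toEquiv, Nat.card_prod, hH] at this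
  obtain ⟨p, hp⟩ := CharP.exists k
  have hpp : Fact p.Prime := ⟨CharP.char_is_prime k p⟩
  have : CharP K p := charP_of_injective_algebraMap (algebraMap k K).injective p
  have hker : IsPGroup p f.ker := by
    rintro ⟨u, hu⟩
    refine ⟨1, Subtype.ext (Units.ext (Subtype.ext ?_))⟩
    have h1 : χ u.1.1 = 1 := congrArg (fun x : Kˣ × Kˣ => (x.1 : K)) hu
    have h2 : (u.1.1).det = 1 := congrArg (fun x : Kˣ × Kˣ => (x.2 : K)) hu
    have h3 : (u.1.1 + (-1 : K) • (1 : Matrix (Fin 2) (Fin 2) K)).det = 0 := by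
      rw [← exists_mulVec_eq_zero_iff]
      refine ⟨w, hw, ?_⟩
      rw [add_mulVec, hχ _ u.1.2, h1, smul_mulVec, one_mulVec]
      simp
    rw [det_add_smul_one, h2] at h3
    -- Eigenvalue $1$ and determinant $1$ make $u$ unipotent: $(u-1)^2=0$, hence $u^p=1$ in
    -- characteristic $p$.
    have h4 : u.1.1.trace = 2 := by linear_combination -h3
    have h5 : (u.1.1 - 1) ^ 2 = 0 := by
      rw [sq, mul_sub, sub_mul, mul_self_eq_trace_smul_sub, h4, h2, two_smul, one_smul, mul_one, one_mul]
      abel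
    have h6 : (u.1.1 - 1) ^ p = 0 := pow_eq_zero_of_le hpp.out.two_le h5
    have h7 : u.1.1 ^ p = 1 := by
      have := add_pow_char_of_commute p (Commute.one_right (u.1.1 - 1))
      rwa [sub_add_cancel, h6, one_pow, zero_add] at this
    simpa using h7
  obtain ⟨n, hn⟩ := IsPGroup.iff_card.1 hker
  intro hdvd
  have hRc : Nat.card Rˣ = p ^ n * Nat.card f.range := by
    rw [← f.ker.card_mul_index, Subgroup.index_ker, hn]
  have hq : 1 < Nat.card k := Finite.one_lt_card
  obtain ⟨m, hm⟩ : ∃ m, Nat.card k = m + 2 := ⟨Nat.card k - 2, by omega⟩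
  have hd : Nat.card k ^ 2 - 1 ∣ p ^ n * ((Nat.card k - 1) * (Nat.card k - 1)) := by
    refine hdvd.trans ?_
    rw [hRc]
    exact mul_dvd_mul_left _ hcard
  have hfact : Nat.card k ^ 2 - 1 = (Nat.card k - 1) * (Nat.card k + 1) := by
    rw [hm, show m + 2 - 1 = m + 1 from rfl]
    rw [Nat.sub_eq_of_eq_add]; ring
  rw [hfact, mul_left_comm] at hd
  have hd2 : Nat.card k + 1 ∣ p ^ n * (Nat.card k - 1) :=
    Nat.dvd_of_mul_dvd_mul_left (by omega) hd
  have hpk : p ∣ Nat.card k := by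
    rw [← CharP.cast_eq_zero_iff k p]
    have := Fintype.ofFinite k
    rw [Nat.card_eq_fintype_card]
    exact FiniteField.cast_card_eq_zero k
  have hcop : Nat.Coprime (Nat.card k + 1) (p ^ n) := by
    apply Nat.Coprime.pow_right
    rw [Nat.coprime_comm, hpp.out.coprime_iff_not_dvd]
    intro h
    exact hpp.out.one_lt.ne' (Nat.dvd_one.1 ((Nat.dvd_add_right hpk).1 h))
  have := Nat.le_of_dvd (by omega) (hcop.dvd_of_dvd_mul_left hd2)
  omega

theorem hasNonsplit_of_dvd_card_units [Finite k] [Finite R]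
    (h : Nat.card k ^ 2 - 1 ∣ Nat.card Rˣ) : HasNonsplit R := by
  by_contra hn
  exact not_dvd_card_units_of_hasCommonEigenvector hk
    (hasCommonEigenvector_of_not_hasNonsplit hk hn) h

omit hk in
theorem det_smul_one_add_smul_ne_zero {M : Matrix (Fin 2) (Fin 2) K}
    (hM : ∀ c : k, (M + algebraMap k K c • (1 : Matrix (Fin 2) (Fin 2) K)).det ≠ 0) {a b : k}
    (hab : (a, b) ≠ 0) : (algebraMap k K a • (1 : Matrix (Fin 2) (Fin 2) K) +
      algebraMap k K b • M).det ≠ 0 := by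
  by_cases hb : b = 0
  · have ha : a ≠ 0 := fun ha => hab (by simp [ha, hb])
    simp [hb, ha]
  · have : algebraMap k K a • (1 : Matrix (Fin 2) (Fin 2) K) + algebraMap k K b • M =
        algebraMap k K b • (M + algebraMap k K (a / b) • (1 : Matrix (Fin 2) (Fin 2) K)) := by
      rw [smul_add, smul_smul, ← map_mul, mul_div_cancel₀ _ hb, add_comm]
    rw [this, det_smul]
    exact mul_ne_zero (pow_ne_zero _ (by simpa using hb)) (hM _)

/-- The subalgebra $k+kM$ has $q^2$ elements and its only singular element is $0$, so it is a field
with cyclic unit group. -/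
theorem exists_isCyclic_of_hasNonsplit [Finite k] [Finite R] (h : HasNonsplit R) :
    ∃ C : Subgroup Rˣ, IsCyclic C ∧ Nat.card C = Nat.card k ^ 2 - 1 := by
  obtain ⟨M, hM, hns⟩ := h
  obtain ⟨t, ht⟩ := exists_trace_eq hk hM
  obtain ⟨d, hd⟩ := exists_det_eq hk hM
  let f : k × k → Matrix (Fin 2) (Fin 2) K := fun ab =>
    algebraMap k K ab.1 • 1 + algebraMap k K ab.2 • M
  have hfadd : ∀ x y, f x + f y = f (x + y) := fun x y => by
    simp only [f, Prod.fst_add, Prod.snd_add, map_add, add_smul]; abel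
  let E : Subalgebra k (Matrix (Fin 2) (Fin 2) K) :=
    { carrier := Set.range f
      mul_mem' := by
        rintro _ _ ⟨⟨a, b⟩, rfl⟩ ⟨⟨a', b'⟩, rfl⟩
        refine ⟨(a * a' - b * b' * d, a * b' + b * a' + b * b' * t), ?_⟩
        simp only [f, add_mul, mul_add, smul_mul_assoc, mul_smul_comm, one_mul, mul_one,
          mul_self_eq_trace_smul_sub M, ← ht, ← hd, map_sub, map_add, map_mul, smul_add, smul_sub,
          add_smul, sub_smul, smul_smul]
        simp only [mul_comm, mul_left_comm]
        abel
      add_mem' := by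
        rintro _ _ ⟨x, rfl⟩ ⟨y, rfl⟩
        exact ⟨x + y, (hfadd x y).symm⟩
      algebraMap_mem' := fun c => ⟨(c, 0), by
        simp [f, Algebra.algebraMap_eq_smul_one]⟩ }
  have hER : E ≤ R := by
    rintro _ ⟨x, rfl⟩
    exact R.add_mem (smul_one_mem _) (algebraMap_smul_mem hM _)
  have hEdet : ∀ N ∈ E, N.det = 0 → N = 0 := by
    rintro _ ⟨x, rfl⟩ h0
    by_cases hx : x = 0
    · simp [hx, f]
    · exact absurd h0 (det_smul_one_add_smul_ne_zero hns hx)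
  have hfinj : Function.Injective f := by
    intro x y hxy
    by_contra hne
    refine det_smul_one_add_smul_ne_zero hns (a := (x - y).1) (b := (x - y).2)
      (sub_ne_zero.2 hne) ?_
    have : f (x - y) = 0 := by
      have := hfadd (x - y) y
      rw [sub_add_cancel, hxy] at this
      exact add_eq_right.1 this
    change (f (x - y)).det = 0
    rw [this, det_zero_fin_two]
  have hEcard : Nat.card E = Nat.card k ^ 2 := by
    rw [sq, ← Nat.card_prod]
    exact (Nat.card_congr (Equiv.ofInjective f hfinj)).symm
  have : Finite E := Finite.of_injective _ (Subalgebra.inclusion_injective hER)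
  obtain ⟨h1, h2, -⟩ := isCyclic_units_and_card hEdet
  let g : Eˣ →* Rˣ := Units.map (Subalgebra.inclusion hER : E →* R)
  have hg : Function.Injective g := Units.map_injective (Subalgebra.inclusion_injective hER)
  refine ⟨g.range, isCyclic_of_surjective _ g.rangeRestrict_surjective, ?_⟩
  rw [← hEcard, ← h2]
  exact (Nat.card_congr (MonoidHom.ofInjective hg).toEquiv).symm

end
end DrinfeldModular
end

noncomputable section

namespace DrinfeldModular

open Matrix

/-! ### Transitivity on the lines of the reduction -/

section

variable {k K : Type*} [Field k] [Field K] [Algebra k K]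
  {R : Subalgebra k (Matrix (Fin 2) (Fin 2) K)}
  {κ : Type*} [Field κ] [Algebra k κ] (ρ : R →ₐ[k] Matrix (Fin 2) (Fin 2) κ)

/-- The units of `R` act transitively on the lines in `κ²`. -/
def IsTransitiveOnLines : Prop :=
  ∀ a b : Fin 2 → κ, a ≠ 0 → b ≠ 0 → ∃ g : Rˣ, ∃ s : κ, ρ g *ᵥ a = s • b

variable {ρ}

/-- The orbit $Ra$ is an image of $Rw$. It contains $0$, so it has fewer than $q^2$ nonzero vectors,
whose $\kappa$-multiples cover $\kappa^2$. Hence $|\kappa|^2\le|\kappa|\,(|Ra|-1)$. -/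
theorem card_lt_of_isTransitiveOnLines [Finite k] [Finite R] [Finite κ]
    (hρ : IsTransitiveOnLines ρ) {w : Fin 2 → K} {a : Fin 2 → κ}
    (hw : Nat.card (Set.range fun M : R => M.1 *ᵥ w) ≤ Nat.card k ^ 2) (ha : a ≠ 0)
    {f : (Fin 2 → K) → Fin 2 → κ} (hf : ∀ M : R, f (M.1 *ᵥ w) = ρ M *ᵥ a) :
    Nat.card κ < Nat.card k ^ 2 := by
  let Y : Set (Fin 2 → κ) := Set.range fun M : R => ρ M *ᵥ a
  have hYfin : Y.Finite := Set.finite_range _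
  have hY : Nat.card Y ≤ Nat.card k ^ 2 := by
    refine le_trans ?_ hw
    have : Y = f '' Set.range fun M : R => M.1 *ᵥ w := by
      rw [← Set.range_comp]
      exact congrArg Set.range (funext fun M => (hf M).symm)
    rw [this]
    exact Set.ncard_image_le (Set.finite_range _)
  have h0 : (0 : Fin 2 → κ) ∈ Y := ⟨0, by simp⟩
  have hY' : Nat.card (Y \ {0} : Set (Fin 2 → κ)) < Nat.card Y :=
    Set.ncard_sdiff_singleton_lt_of_mem h0 hYfin
  let g : κ × (Y \ {0} : Set (Fin 2 → κ)) → Fin 2 → κ := fun x => x.1 • x.2.1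
  have hg : Function.Surjective g := by
    intro b
    by_cases hb : b = 0
    · exact ⟨(0, ⟨a, ⟨1, by simp⟩, ha⟩), by simp [g, hb]⟩
    · obtain ⟨u, s, hs⟩ := hρ a b ha hb
      have hu : ρ u *ᵥ a ≠ 0 := by
        intro h
        apply ha
        have : ρ (↑u⁻¹ : R) *ᵥ (ρ u *ᵥ a) = a := by
          rw [mulVec_mulVec, ← map_mul, Units.inv_mul, map_one, one_mulVec]
        rw [← this, h, mulVec_zero]
      have hs0 : s ≠ 0 := by
        rintro rfl
        exact hu (by rw [hs, zero_smul])
      exact ⟨(s⁻¹, ⟨ρ u *ᵥ a, ⟨u, rfl⟩, hu⟩), by simp [g, hs, hs0]⟩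
  have hc := Nat.card_le_card_of_surjective g hg
  rw [Nat.card_prod, Nat.card_fun, Nat.card_fin, sq] at hc
  have := Nat.le_of_mul_le_mul_left hc Nat.card_pos
  omega

theorem exists_algebraMap_eq_of_finrank_eq_one (h1 : Module.finrank k κ = 1) (s : κ) :
    ∃ c : k, algebraMap k κ c = s := by
  obtain ⟨c, hc⟩ := (finrank_eq_one_iff_of_nonzero' (1 : κ) one_ne_zero).1 h1 s
  exact ⟨c, by rw [Algebra.algebraMap_eq_smul_one, hc]⟩

/-- When $\kappa=k$ the scalars $k^\times$ lie in $R^\times$, so transitivity on lines becomes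
transitivity on the $q^2-1$ nonzero vectors, and an orbit's size divides the group order. -/
theorem dvd_card_units_of_isTransitiveOnLines [Finite k] [Finite κ]
    (hρ : IsTransitiveOnLines ρ) (h1 : Module.finrank k κ = 1) :
    Nat.card k ^ 2 - 1 ∣ Nat.card Rˣ := by
  let Φ : Rˣ →* (Module.End κ (Fin 2 → κ))ˣ := Units.map
    ((toLinAlgEquiv' (R := κ) (n := Fin 2) : _ →* _).comp (ρ : R →* Matrix (Fin 2) (Fin 2) κ))
  let _ : MulAction Rˣ (Fin 2 → κ) := MulAction.compHom _ Φ
  have hsmul : ∀ (g : Rˣ) (a : Fin 2 → κ), g • a = ρ g *ᵥ a := fun g a => rfl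
  let a : Fin 2 → κ := fun _ => 1
  have ha : a ≠ 0 := fun h => one_ne_zero (congrFun h 0)
  have horb : MulAction.orbit Rˣ a = {0}ᶜ := by
    ext b
    constructor
    · rintro ⟨g, rfl⟩ (h : g • a = 0)
      apply ha
      rw [← inv_smul_smul g a, h, hsmul, mulVec_zero]
    · intro hb
      obtain ⟨g, s, hs⟩ := hρ a b ha hb
      obtain ⟨c, rfl⟩ := exists_algebraMap_eq_of_finrank_eq_one h1 s
      have hc0 : c ≠ 0 := by
        rintro rfl
        apply ha
        rw [map_zero, zero_smul, ← hsmul] at hs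
        rw [← inv_smul_smul g a, hs, hsmul, mulVec_zero]
      let u : Rˣ := Units.map (algebraMap k R : k →* R) (Units.mk0 c hc0)⁻¹
      refine ⟨u * g, ?_⟩
      change (u * g) • a = b
      rw [mul_smul, hsmul g, hs, hsmul]
      have : ρ u = algebraMap k (Matrix (Fin 2) (Fin 2) κ) c⁻¹ := by
        simp [u]
      rw [this, Algebra.algebraMap_eq_smul_one, mulVec_smul, smul_mulVec, one_mulVec,
        algebraMap_smul, smul_smul, mul_inv_cancel₀ hc0, one_smul]
  have hκ : Nat.card κ = Nat.card k := by
    have := Module.natCard_eq_pow_finrank (K := k) (V := κ)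
    rwa [h1, pow_one] at this
  have hcard : Nat.card (MulAction.orbit Rˣ a) = Nat.card k ^ 2 - 1 := by
    rw [horb]
    change Set.ncard _ = _
    rw [Set.ncard_compl, Set.ncard_singleton, Nat.card_fun, Nat.card_fin, hκ]
  rw [← hcard, Nat.card_congr (MulAction.orbitEquivQuotientStabilizer Rˣ a)]
  exact Subgroup.index_dvd_card _

variable (hk : ∀ y : K, IsAlgebraic k y → y ∈ (algebraMap k K).range)
include hk

/-- Nonzero elements $x+yM$ are units, so $(x,y)\mapsto\rho(x+yM)a$ is injective. By dimension it is
onto $\kappa^2$. -/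
theorem isTransitiveOnLines_of_hasNonsplit [Finite R] (h : HasNonsplit R)
    (h1 : Module.finrank k κ = 1) : IsTransitiveOnLines ρ := by
  obtain ⟨M, hM, hns⟩ := h
  intro a b ha hb
  let N : k → k → R := fun x y => ⟨algebraMap k K x • 1 + algebraMap k K y • M,
    R.add_mem (smul_one_mem _) (algebraMap_smul_mem hM _)⟩
  have hN : ∀ x y, N x y = x • 1 + y • ⟨M, hM⟩ := fun x y => Subtype.ext (by simp [N])
  have hunit : ∀ x y, (x, y) ≠ 0 → IsUnit (N x y) := fun x y hxy =>
    mem_isUnit hk _ (det_smul_one_add_smul_ne_zero hns hxy)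
  have hρN : ∀ x y, ρ (N x y) *ᵥ a = x • a + y • (ρ ⟨M, hM⟩ *ᵥ a) := fun x y => by
    rw [hN, map_add, map_smul, map_smul, map_one, add_mulVec, smul_mulVec, smul_mulVec,
      one_mulVec]
  have hne : ∀ x y, (x, y) ≠ 0 → ρ (N x y) *ᵥ a ≠ 0 := fun x y hxy h => by
    obtain ⟨u, hu⟩ := hunit x y hxy
    apply ha
    have : ρ (↑u⁻¹ : R) *ᵥ (ρ u *ᵥ a) = a := by
      rw [mulVec_mulVec, ← map_mul, Units.inv_mul, map_one, one_mulVec]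
    rw [← this, hu, h, mulVec_zero]
  let L : k × k →ₗ[k] Fin 2 → κ :=
    { toFun := fun x => x.1 • a + x.2 • (ρ ⟨M, hM⟩ *ᵥ a)
      map_add' := fun x y => by simp only [Prod.fst_add, Prod.snd_add, add_smul]; abel
      map_smul' := fun c x => by
        simp only [Prod.smul_fst, Prod.smul_snd, smul_assoc, smul_add, RingHom.id_apply] }
  have hL : Function.Injective L := by
    rw [injective_iff_map_eq_zero]
    intro x hx
    by_contra h0
    exact hne x.1 x.2 h0 ((hρN _ _).trans hx)
  have : FiniteDimensional k κ := FiniteDimensional.of_finrank_pos (by omega)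
  have hL' : Function.Surjective L := by
    rw [← LinearMap.injective_iff_surjective_of_finrank_eq_finrank]
    · exact hL
    · simp [Module.finrank_pi_fintype, h1]
  obtain ⟨x, hx⟩ := hL' b
  have hx0 : x ≠ 0 := fun h => hb (by rw [← hx, h, map_zero])
  obtain ⟨u, hu⟩ := hunit x.1 x.2 hx0
  refine ⟨u, 1, ?_⟩
  rw [hu, hρN, one_smul]
  exact hx

/-- The units of `R` act transitively on the lines of `κ²` if and only if `κ = k` and `|k|² - 1`
divides the number of units of `R`, provided that `ρ` is a reduction of the action on `K²`. -/
theorem isTransitiveOnLines_iff [Finite k] [Finite R] [Finite κ]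
    (hρ : ∀ w : Fin 2 → K, w ≠ 0 → ∃ a : Fin 2 → κ, a ≠ 0 ∧
      ∃ f : (Fin 2 → K) → Fin 2 → κ, ∀ M : R, f (M.1 *ᵥ w) = ρ M *ᵥ a) :
    IsTransitiveOnLines ρ ↔ Module.finrank k κ = 1 ∧ Nat.card k ^ 2 - 1 ∣ Nat.card Rˣ := by
  constructor
  · intro h
    obtain ⟨w, hw, hcard⟩ := exists_card_range_mulVec_le (R := R) hk
    obtain ⟨a, ha, f, hf⟩ := hρ w hw
    have hlt := card_lt_of_isTransitiveOnLines h hcard ha hf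
    -- The inequality reads $q^\delta<q^2$.
    have h1 : Module.finrank k κ = 1 := by
      rw [Module.natCard_eq_pow_finrank (K := k) (V := κ)] at hlt
      have := (Nat.pow_lt_pow_iff_right (Finite.one_lt_card (α := k))).1 hlt
      have := Module.finrank_pos (R := k) (M := κ)
      omega
    exact ⟨h1, dvd_card_units_of_isTransitiveOnLines h h1⟩
  · rintro ⟨h1, hd⟩
    exact isTransitiveOnLines_of_hasNonsplit hk (hasNonsplit_of_dvd_card_units hk hd) h1

end
end DrinfeldModular
end

noncomputable section

namespace DrinfeldModular

open Matrix IsLocalRing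

/-! ### The neighbours of the standard vertex -/

section Plane

variable {κ : Type*} [Field κ]

theorem exists_eq_smul_add_smul {u x : Fin 2 → κ} (hu : u ≠ 0) (hx : ∀ c : κ, x ≠ c • u)
    (y : Fin 2 → κ) : ∃ α β : κ, y = α • x + β • u := by
  have hd : x 0 * u 1 - x 1 * u 0 ≠ 0 := by
    intro h
    by_cases h0 : u 0 = 0
    · have h1 : u 1 ≠ 0 := fun h1 => hu (by ext i; fin_cases i <;> simp [h0, h1])
      apply hx (x 1 / u 1)
      have : x 0 = 0 := by simpa [h0, h1] using h
      ext i
      fin_cases i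
      · simp [h0, this]
      · simp [h1]
    · apply hx (x 0 / u 0)
      ext i
      fin_cases i
      · simp [h0]
      · simp only [Fin.mk_one, Pi.smul_apply, smul_eq_mul]
        field_simp
        linear_combination -h
  refine ⟨(y 0 * u 1 - y 1 * u 0) / (x 0 * u 1 - x 1 * u 0),
    (x 0 * y 1 - x 1 * y 0) / (x 0 * u 1 - x 1 * u 0), ?_⟩
  ext i
  fin_cases i
  · simp only [Fin.zero_eta, Pi.add_apply, Pi.smul_apply, smul_eq_mul]
    rw [div_mul_eq_mul_div, div_mul_eq_mul_div, ← add_div, eq_div_iff hd]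
    ring
  · simp only [Fin.mk_one, Pi.add_apply, Pi.smul_apply, smul_eq_mul]
    rw [div_mul_eq_mul_div, div_mul_eq_mul_div, ← add_div, eq_div_iff hd]
    ring

end Plane

/-! ### Submodules of $R^2$ lying over lines of $\kappa^2$ -/

section LocalRing

variable (R : Type*) [CommRing R] [IsLocalRing R]

/-- The reduction map `R² → κ²`. -/
def reduction : (Fin 2 → R) →ₗ[R] Fin 2 → ResidueField R :=
  (Algebra.linearMap R (ResidueField R)).compLeft (Fin 2)

variable {R}

theorem reduction_apply (x : Fin 2 → R) (i : Fin 2) : reduction R x i = residue R (x i) := rfl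

theorem reduction_surjective : Function.Surjective (reduction R) := fun y => by
  choose x hx using fun i => residue_surjective (y i)
  exact ⟨x, funext hx⟩

theorem reduction_smul (r : R) (x : Fin 2 → R) :
    reduction R (r • x) = residue R r • reduction R x := by
  ext i
  simp [reduction_apply]

/-- The vectors of `R²` whose reduction lies on the line spanned by `u`. -/
def lineModule (u : Fin 2 → ResidueField R) : Submodule R (Fin 2 → R) :=
  ((Submodule.span (ResidueField R) {u}).restrictScalars R).comap (reduction R)

theorem mem_lineModule {u : Fin 2 → ResidueField R} {x : Fin 2 → R} :
    x ∈ lineModule u ↔ ∃ c : ResidueField R, reduction R x = c • u := by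
  simp [lineModule, Submodule.mem_span_singleton, eq_comm]

theorem ker_reduction_le_lineModule (u : Fin 2 → ResidueField R) :
    LinearMap.ker (reduction R) ≤ lineModule u := fun x hx =>
  mem_lineModule.2 ⟨0, by rw [zero_smul]; exact hx⟩

theorem mem_of_reduction_eq {N : Submodule R (Fin 2 → R)} (hN : LinearMap.ker (reduction R) ≤ N)
    {x y : Fin 2 → R} (hx : x ∈ N) (h : reduction R y = reduction R x) : y ∈ N := by
  have : y - x ∈ N := hN (by rw [LinearMap.mem_ker, map_sub, h, sub_self])
  simpa using N.add_mem this hx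

theorem lineModule_ne_top (u : Fin 2 → ResidueField R) : lineModule u ≠ ⊤ := by
  intro h
  have h' : ∀ y : Fin 2 → ResidueField R, ∃ c : ResidueField R, y = c • u := fun y => by
    obtain ⟨x, rfl⟩ := reduction_surjective y
    exact mem_lineModule.1 (h ▸ Submodule.mem_top)
  obtain ⟨c, hc⟩ := h' ![1, 0]
  obtain ⟨d, hd⟩ := h' ![0, 1]
  have h1 := congrFun hc 0
  have h2 := congrFun hc 1
  have h3 := congrFun hd 0
  have h4 := congrFun hd 1
  simp at h1 h2 h3 h4
  rcases h2 with h2 | h2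
  · simp [h2] at h1
  · simp [h2] at h4

theorem lineModule_covBy_top {u : Fin 2 → ResidueField R} (hu : u ≠ 0) :
    lineModule u ⋖ (⊤ : Submodule R (Fin 2 → R)) := by
  refine ⟨lt_top_iff_ne_top.2 (lineModule_ne_top u), fun N h1 h2 => h2.ne ?_⟩
  obtain ⟨x, hxN, hx⟩ := SetLike.exists_of_lt h1
  rw [mem_lineModule, not_exists] at hx
  refine eq_top_iff.2 fun y _ => ?_
  obtain ⟨α, β, h⟩ := exists_eq_smul_add_smul hu hx (reduction R y)
  obtain ⟨a, rfl⟩ := residue_surjective α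
  obtain ⟨z, rfl⟩ := reduction_surjective u
  obtain ⟨b, rfl⟩ := residue_surjective β
  have hz : z ∈ N := h1.le (mem_lineModule.2 ⟨1, by simp⟩)
  refine mem_of_reduction_eq ((ker_reduction_le_lineModule _).trans h1.le)
    (N.add_mem (N.smul_mem a hxN) (N.smul_mem b hz)) ?_
  rw [h, map_add, reduction_smul, reduction_smul]

theorem ker_reduction_covBy_lineModule {u : Fin 2 → ResidueField R} (hu : u ≠ 0) :
    LinearMap.ker (reduction R) ⋖ lineModule u := by
  obtain ⟨z, rfl⟩ := reduction_surjective u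
  refine ⟨lt_of_le_of_ne (ker_reduction_le_lineModule _) fun h => hu ?_, fun N h1 h2 => h2.ne ?_⟩
  · have : z ∈ LinearMap.ker (reduction R) := h ▸ mem_lineModule.2 ⟨1, by simp⟩
    exact this
  · obtain ⟨x, hxN, hx⟩ := SetLike.exists_of_lt h1
    obtain ⟨α, hα⟩ := mem_lineModule.1 (h2.le hxN)
    have hα0 : α ≠ 0 := fun h => hx (by rw [LinearMap.mem_ker, hα, h, zero_smul])
    refine h2.le.antisymm fun y hy => ?_
    obtain ⟨β, hβ⟩ := mem_lineModule.1 hy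
    obtain ⟨c, hc⟩ := residue_surjective (β / α)
    refine mem_of_reduction_eq h1.le (N.smul_mem c hxN) ?_
    rw [reduction_smul, hα, hβ, hc, smul_smul, div_mul_cancel₀ _ hα0]

theorem ker_reduction_eq : LinearMap.ker (reduction R) =
    maximalIdeal R • (⊤ : Submodule R (Fin 2 → R)) := by
  apply le_antisymm
  · intro x hx
    have hx' : ∀ i, x i ∈ maximalIdeal R := fun i => by
      rw [← residue_eq_zero_iff]; exact congrFun hx i
    rw [show x = ∑ i, x i • Pi.single i 1 from (by simpa using (pi_eq_sum_univ' x))]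
    exact Submodule.sum_mem _ fun i _ => Submodule.smul_mem_smul (hx' i) Submodule.mem_top
  · rw [Submodule.smul_le]
    intro r hr x _
    rw [LinearMap.mem_ker, reduction_smul, (residue_eq_zero_iff r).2 hr, zero_smul]

theorem exists_eq_lineModule_of_covBy_top {N : Submodule R (Fin 2 → R)} (hN : N ⋖ ⊤) :
    ∃ u : Fin 2 → ResidueField R, u ≠ 0 ∧ N = lineModule u := by
  -- By Nakayama a maximal submodule contains $\mathfrak m R^2$; otherwise $N+\mathfrak mR^2=R^2$
  -- would give $N=R^2$.
  have hker : LinearMap.ker (reduction R) ≤ N := by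
    by_contra h
    have hlt : N < N ⊔ LinearMap.ker (reduction R) := left_lt_sup.2 h
    have htop : N ⊔ LinearMap.ker (reduction R) = ⊤ :=
      not_lt_top_iff.1 (hN.2 hlt)
    rw [ker_reduction_eq] at htop
    have := Submodule.le_of_le_smul_of_le_jacobson_bot (N' := (⊤ : Submodule R (Fin 2 → R)))
      (N := N) Module.Finite.fg_top (IsLocalRing.jacobson_eq_maximalIdeal ⊥ bot_ne_top).ge htop.ge
    exact hN.1.ne (eq_top_iff.2 this)
  suffices h : ∃ u : Fin 2 → ResidueField R, u ≠ 0 ∧ N ≤ lineModule u by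
    obtain ⟨u, hu, h⟩ := h
    refine ⟨u, hu, ?_⟩
    rcases h.eq_or_lt with h | h
    · exact h
    · exact absurd (lt_top_iff_ne_top.2 (lineModule_ne_top u)) (hN.2 h)
  by_cases hx : ∃ x ∈ N, reduction R x ≠ 0
  · obtain ⟨x, hxN, hx⟩ := hx
    refine ⟨_, hx, fun y hy => ?_⟩
    by_contra hy'
    rw [mem_lineModule, not_exists] at hy'
    refine hN.1.ne (eq_top_iff.2 fun z _ => ?_)
    obtain ⟨α, β, h⟩ := exists_eq_smul_add_smul hx hy' (reduction R z)
    obtain ⟨a, rfl⟩ := residue_surjective α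
    obtain ⟨b, rfl⟩ := residue_surjective β
    refine mem_of_reduction_eq hker (N.add_mem (N.smul_mem a hy) (N.smul_mem b hxN)) ?_
    rw [h, map_add, reduction_smul, reduction_smul]
  · push Not at hx
    refine ⟨fun _ => 1, fun h => one_ne_zero (congrFun h 0), fun y hy => ?_⟩
    exact mem_lineModule.2 ⟨0, by rw [hx y hy, zero_smul]⟩

theorem eq_smul_of_lineModule_eq {u u' : Fin 2 → ResidueField R}
    (h : lineModule u = lineModule u') : ∃ c : ResidueField R, u = c • u' := by
  obtain ⟨z, rfl⟩ := reduction_surjective u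
  exact mem_lineModule.1 (h ▸ mem_lineModule.2 ⟨1, by simp⟩)

theorem reduction_mulVec (g : Matrix (Fin 2) (Fin 2) R) (x : Fin 2 → R) :
    reduction R (g *ᵥ x) = g.map (residue R) *ᵥ reduction R x :=
  funext fun i => RingHom.map_mulVec (residue R) g x i

theorem mulVec_mem_lineModule (g : Matrix (Fin 2) (Fin 2) R) {u : Fin 2 → ResidueField R}
    {x : Fin 2 → R} (hx : x ∈ lineModule u) :
    g *ᵥ x ∈ lineModule (g.map (residue R) *ᵥ u) := by
  obtain ⟨c, hc⟩ := mem_lineModule.1 hx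
  exact mem_lineModule.2 ⟨c, by rw [reduction_mulVec, hc, mulVec_smul]⟩

end LocalRing

end DrinfeldModular
end

noncomputable section

namespace DrinfeldModular

open Matrix IsLocalRing

/-! ### The action of $GL_2(F)$ on lattices and vertices -/

section LatticeAction

variable {R F : Type*} [CommRing R] [Field F] [Algebra R F]

theorem GL_inv_mulVec_mulVec (g : GeneralLinearGroup (Fin 2) F) (x : Fin 2 → F) :
    g⁻¹.1 *ᵥ (g.1 *ᵥ x) = x := by
  rw [mulVec_mulVec, ← Units.val_mul, inv_mul_cancel, Units.val_one, one_mulVec]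

theorem GL_mulVec_inv_mulVec (g : GeneralLinearGroup (Fin 2) F) (x : Fin 2 → F) :
    g.1 *ᵥ (g⁻¹.1 *ᵥ x) = x := by
  rw [mulVec_mulVec, ← Units.val_mul, mul_inv_cancel, Units.val_one, one_mulVec]

theorem Lattice.mem_smul {g : GeneralLinearGroup (Fin 2) F} {L : Lattice R F} {x : Fin 2 → F} :
    x ∈ (g • L).1 ↔ g⁻¹.1 *ᵥ x ∈ L.1 := by
  rw [Lattice.smul_val, Submodule.mem_map]
  constructor
  · rintro ⟨y, hy, rfl⟩
    exact (GL_inv_mulVec_mulVec g y).symm ▸ hy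
  · intro h
    exact ⟨_, h, GL_mulVec_inv_mulVec g x⟩

theorem Lattice.mulVec_mem_smul {g : GeneralLinearGroup (Fin 2) F} {L : Lattice R F}
    {x : Fin 2 → F} (hx : x ∈ L.1) : g.1 *ᵥ x ∈ (g • L).1 := by
  rw [Lattice.smul_val]
  exact ⟨x, hx, rfl⟩

theorem Lattice.smul_le_smul {g : GeneralLinearGroup (Fin 2) F} {L L' : Lattice R F}
    (h : L.1 ≤ L'.1) : (g • L).1 ≤ (g • L').1 :=
  Submodule.map_mono h

theorem Lattice.smul_le_smul_iff {g : GeneralLinearGroup (Fin 2) F} {L L' : Lattice R F} :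
    (g • L).1 ≤ (g • L').1 ↔ L.1 ≤ L'.1 := by
  refine ⟨fun h => ?_, Lattice.smul_le_smul⟩
  have := Lattice.smul_le_smul (g := g⁻¹) h
  rwa [inv_smul_smul, inv_smul_smul] at this

theorem Lattice.smul_covBy_smul {g : GeneralLinearGroup (Fin 2) F} {L L' : Lattice R F}
    (h : L.1 ⋖ L'.1) : (g • L).1 ⋖ (g • L').1 := by
  let e : (Fin 2 → F) ≃ₗ[R] (Fin 2 → F) :=
    { toLinearMap := (Matrix.mulVecLin g.1).restrictScalars R
      invFun := fun x => g⁻¹.1 *ᵥ x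
      left_inv := GL_inv_mulVec_mulVec g
      right_inv := GL_mulVec_inv_mulVec g }
  exact (apply_covBy_apply_iff (Submodule.orderIsoMapComap e)).2 h

@[simp]
theorem scalarGL_val (c : Fˣ) : (scalarGL c).1 = (c : F) • (1 : Matrix (Fin 2) (Fin 2) F) := by
  rw [smul_one_eq_diagonal]
  rfl

theorem scalarGL_inv (c : Fˣ) : (scalarGL c)⁻¹ = scalarGL c⁻¹ := (map_inv _ c).symm

theorem mem_scalarGL_smul {c : Fˣ} {L : Lattice R F} {x : Fin 2 → F} :
    x ∈ (scalarGL c • L).1 ↔ (c : F)⁻¹ • x ∈ L.1 := by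
  rw [Lattice.mem_smul, scalarGL_inv, scalarGL_val, smul_mulVec, one_mulVec,
    Units.val_inv_eq_inv_val]

theorem scalarGL_smul_eq_of_isUnit {c : Fˣ} {r s : R} (hr : algebraMap R F r = c)
    (hs : algebraMap R F s = (c : F)⁻¹) (L : Lattice R F) : scalarGL c • L = L := by
  apply Subtype.ext
  ext x
  rw [mem_scalarGL_smul, ← hs, algebraMap_smul]
  refine ⟨fun h => ?_, fun h => L.1.smul_mem _ h⟩
  have := L.1.smul_mem r h
  rwa [← algebraMap_smul F r, ← algebraMap_smul F s, smul_smul, hr, hs,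
    mul_inv_cancel₀ c.ne_zero, one_smul] at this

theorem Vertex.mk_eq_mk {L L' : Lattice R F} :
    Vertex.mk L = Vertex.mk L' ↔ ∃ c : Fˣ, L' = scalarGL c • L := Quotient.eq

theorem Vertex.mk_scalarGL_smul (c : Fˣ) (L : Lattice R F) :
    Vertex.mk (scalarGL c • L) = Vertex.mk L :=
  (Vertex.mk_eq_mk.2 ⟨c, rfl⟩).symm

theorem Vertex.exists_mk (v : Vertex R F) : ∃ L, Vertex.mk L = v := Quotient.exists_rep v

theorem tree_adj_smul {v w : Vertex R F} (g : GeneralLinearGroup (Fin 2) F)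
    (h : (tree R F).Adj v w) : (tree R F).Adj (g • v) (g • w) := by
  have key : ∀ {v w : Vertex R F},
      (∃ L₁ L₂ : Lattice R F, Vertex.mk L₁ = v ∧ Vertex.mk L₂ = w ∧ L₂.1 ⋖ L₁.1) →
      (∃ L₁ L₂ : Lattice R F, Vertex.mk L₁ = g • v ∧ Vertex.mk L₂ = g • w ∧ L₂.1 ⋖ L₁.1) := by
    rintro _ _ ⟨L₁, L₂, rfl, rfl, h⟩
    exact ⟨g • L₁, g • L₂, rfl, rfl, Lattice.smul_covBy_smul h⟩
  rw [tree, SimpleGraph.fromRel_adj] at h ⊢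
  exact ⟨fun h' => h.1 (smul_left_cancel g h'), h.2.imp key key⟩

theorem tree_adj_smul_iff {v w : Vertex R F} (g : GeneralLinearGroup (Fin 2) F) :
    (tree R F).Adj (g • v) (g • w) ↔ (tree R F).Adj v w := by
  refine ⟨fun h => ?_, tree_adj_smul g⟩
  have := tree_adj_smul g⁻¹ h
  rwa [inv_smul_smul, inv_smul_smul] at this

end LatticeAction

section CoordMap

variable (R F : Type*) [CommRing R] [Field F] [Algebra R F]

/-- The inclusion `R² → F²`. -/
def coordMap : (Fin 2 → R) →ₗ[R] Fin 2 → F := (Algebra.linearMap R F).compLeft (Fin 2)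

variable {R F}

theorem coordMap_apply (x : Fin 2 → R) (i : Fin 2) : coordMap R F x i = algebraMap R F (x i) := rfl

theorem coordMap_injective [IsFractionRing R F] : Function.Injective (coordMap R F) := fun _ _ h =>
  funext fun i => IsFractionRing.injective R F (congrFun h i)

theorem coordMap_mulVec (g : Matrix (Fin 2) (Fin 2) R) (x : Fin 2 → R) :
    coordMap R F (g *ᵥ x) = g.map (algebraMap R F) *ᵥ coordMap R F x :=
  funext fun i => RingHom.map_mulVec (algebraMap R F) g x i

theorem coordMap_smul (r : R) (x : Fin 2 → R) :
    coordMap R F (r • x) = algebraMap R F r • coordMap R F x := by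
  rw [map_smul, algebraMap_smul]

/-- Every submodule of $F^2$ below the image of $R^2$ is itself an image, so nothing new fits
between two images. -/
theorem map_coordMap_covBy_iff [IsFractionRing R F] {N N' : Submodule R (Fin 2 → R)} :
    N.map (coordMap R F) ⋖ N'.map (coordMap R F) ↔ N ⋖ N' := by
  let f : Submodule R (Fin 2 → R) ↪o Submodule R (Fin 2 → F) :=
    OrderEmbedding.ofMapLEIff (Submodule.map (coordMap R F))
      fun a b => Submodule.map_le_map_iff_of_injective coordMap_injective a b
  refine Set.OrdConnected.apply_covBy_apply_iff f ⟨?_⟩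
  rintro _ - _ ⟨N', rfl⟩ L hL
  refine ⟨L.comap (coordMap R F), Submodule.map_comap_eq_self ?_⟩
  rw [← Submodule.map_top]
  exact hL.2.trans (Submodule.map_mono le_top)

end CoordMap

/-! ### The standard lattice and its sublattices of colength one -/

section StandardLattice

variable {R F : Type*} [CommRing R] [IsDomain R] [IsDiscreteValuationRing R] [Field F]
  [Algebra R F] [IsFractionRing R F]

/-- The lattice in `F²` defined by a submodule of `R²` that contains the kernel of the
reduction map. -/
def latticeOfLE (N : Submodule R (Fin 2 → R)) (hN : LinearMap.ker (reduction R) ≤ N) :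
    Lattice R F :=
  ⟨N.map (coordMap R F), by
    refine ⟨(IsNoetherian.noetherian N).map _, eq_top_iff.2 fun x _ => ?_⟩
    obtain ⟨ϖ, hϖ⟩ := IsDiscreteValuationRing.exists_irreducible R
    have hϖF : algebraMap R F ϖ ≠ 0 := by simpa using hϖ.ne_zero
    have hmem : ∀ i : Fin 2, (Pi.single i 1 : Fin 2 → F) ∈
        Submodule.span F (N.map (coordMap R F) : Set (Fin 2 → F)) := by
      intro i
      have h1 : ϖ • (Pi.single i 1 : Fin 2 → R) ∈ N := hN (by
        rw [LinearMap.mem_ker, reduction_smul,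
          (residue_eq_zero_iff ϖ).2 ((mem_maximalIdeal _).2 hϖ.not_isUnit), zero_smul])
      have h2 : coordMap R F (Pi.single i 1) = Pi.single i 1 := by
        ext j
        by_cases h : j = i
        · subst h; simp [coordMap_apply]
        · simp [coordMap_apply, h]
      have h3 := Submodule.smul_mem _ (algebraMap R F ϖ)⁻¹
        (Submodule.subset_span (R := F) (Submodule.mem_map_of_mem (f := coordMap R F) h1))
      rwa [coordMap_smul, smul_smul, inv_mul_cancel₀ hϖF, one_smul, h2] at h3
    rw [show x = ∑ i, x i • Pi.single i 1 from (by simpa using (pi_eq_sum_univ' x))]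
    exact Submodule.sum_mem _ fun i _ => Submodule.smul_mem _ _ (hmem i)⟩

variable (R F) in
/-- The lattice `R²`. -/
def stdLattice : Lattice R F := latticeOfLE ⊤ le_top

variable (F) in
/-- The lattice of all vectors of `R²` whose reduction lies on a given line. -/
def lineLattice (u : Fin 2 → ResidueField R) : Lattice R F :=
  latticeOfLE (lineModule u) (ker_reduction_le_lineModule u)

theorem mem_stdLattice {x : Fin 2 → F} :
    x ∈ (stdLattice R F).1 ↔ ∃ y : Fin 2 → R, coordMap R F y = x := by
  change x ∈ Submodule.map _ _ ↔ _
  simp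

theorem lineLattice_le (u : Fin 2 → ResidueField R) :
    (lineLattice F u).1 ≤ (stdLattice R F).1 := Submodule.map_mono le_top

theorem lineLattice_covBy {u : Fin 2 → ResidueField R} (hu : u ≠ 0) :
    (lineLattice F u).1 ⋖ (stdLattice R F).1 :=
  map_coordMap_covBy_iff.2 (lineModule_covBy_top hu)

theorem smul_mem_lineLattice {ϖ : R} (hϖ : ¬ IsUnit ϖ) {x : Fin 2 → F}
    (hx : x ∈ (stdLattice R F).1) (u : Fin 2 → ResidueField R) :
    algebraMap R F ϖ • x ∈ (lineLattice F u).1 := by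
  obtain ⟨y, rfl⟩ := mem_stdLattice.1 hx
  refine ⟨ϖ • y, mem_lineModule.2 ⟨0, ?_⟩, coordMap_smul _ _⟩
  rw [reduction_smul, (residue_eq_zero_iff ϖ).2 ((mem_maximalIdeal _).2 hϖ), zero_smul, zero_smul]

theorem map_coordMap_ker_reduction {ϖ : R} (hϖ : Irreducible ϖ) {c : Fˣ}
    (hc : (c : F) = algebraMap R F ϖ) :
    (LinearMap.ker (reduction R)).map (coordMap R F) = (scalarGL c • stdLattice R F).1 := by
  ext x
  rw [mem_scalarGL_smul, mem_stdLattice]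
  have hc0 := c.ne_zero
  rw [hc] at hc0 ⊢
  constructor
  · rintro ⟨y, hy, rfl⟩
    have h : ∀ i, ∃ z, y i = ϖ * z := fun i => by
      have h1 : y i ∈ maximalIdeal R := (residue_eq_zero_iff _).1 (congrFun hy i)
      rw [hϖ.maximalIdeal_eq] at h1
      exact Ideal.mem_span_singleton.1 h1
    choose z hz using h
    refine ⟨z, ?_⟩
    rw [show y = ϖ • z from funext hz, coordMap_smul, smul_smul, inv_mul_cancel₀ hc0, one_smul]
  · rintro ⟨y, hy⟩
    refine ⟨ϖ • y, ?_, ?_⟩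
    · change reduction R _ = 0
      rw [reduction_smul, (residue_eq_zero_iff ϖ).2 ((mem_maximalIdeal _).2 hϖ.not_isUnit),
        zero_smul]
    · rw [coordMap_smul, hy, smul_smul, mul_inv_cancel₀ hc0, one_smul]

theorem scalarGL_smul_std_covBy_lineLattice {ϖ : R} (hϖ : Irreducible ϖ) {c : Fˣ}
    (hc : (c : F) = algebraMap R F ϖ) {u : Fin 2 → ResidueField R} (hu : u ≠ 0) :
    (scalarGL c • stdLattice R F).1 ⋖ (lineLattice F u).1 := by
  rw [← map_coordMap_ker_reduction hϖ hc]
  exact map_coordMap_covBy_iff.2 (ker_reduction_covBy_lineModule hu)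

theorem exists_eq_lineLattice_of_covBy {L : Lattice R F} (h : L.1 ⋖ (stdLattice R F).1) :
    ∃ u : Fin 2 → ResidueField R, u ≠ 0 ∧ L = lineLattice F u := by
  have hL : (L.1.comap (coordMap R F)).map (coordMap R F) = L.1 := by
    apply Submodule.map_comap_eq_self
    rw [← Submodule.map_top]
    exact h.le
  rw [← hL] at h
  obtain ⟨u, hu, hu'⟩ := exists_eq_lineModule_of_covBy_top (map_coordMap_covBy_iff.1 h)
  exact ⟨u, hu, Subtype.ext (by rw [← hL, hu']; rfl)⟩

/-- Every lattice is of the form `g R²`. -/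
theorem exists_smul_stdLattice_eq (L : Lattice R F) :
    ∃ g : GeneralLinearGroup (Fin 2) F, g • stdLattice R F = L := by
  have := L.2
  have : Module.Free R L.1 := Submodule.IsLattice.free (K := F) L.1
  have hrank : Module.finrank R L.1 = 2 := by
    rw [Submodule.IsLattice.finrank_of_pi (K := F), Fintype.card_fin]
  let b : Module.Basis (Fin 2) R L.1 := Module.finBasisOfFinrankEq R L.1 hrank
  let b' : Module.Basis (Fin 2) F (Fin 2 → F) := b.extendOfIsLattice F
  have hb' : ∀ i, b' i = (b i).1 := fun i => b.extendOfIsLattice_apply F i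
  let e := b'.equivFun.symm
  let g : GeneralLinearGroup (Fin 2) F :=
    ⟨LinearMap.toMatrix' e.toLinearMap, LinearMap.toMatrix' e.symm.toLinearMap,
      by rw [← LinearMap.toMatrix'_comp]; simp, by rw [← LinearMap.toMatrix'_comp]; simp⟩
  have hg : ∀ x, g.1 *ᵥ x = ∑ i, x i • (b i).1 := fun x => by
    change LinearMap.toMatrix' e.toLinearMap *ᵥ x = _
    rw [LinearMap.toMatrix'_mulVec]
    simp [e, Module.Basis.equivFun_symm_apply, hb']
  have hgc : ∀ y : Fin 2 → R, g.1 *ᵥ coordMap R F y = (b.equivFun.symm y).1 := fun y => by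
    rw [hg, b.equivFun_symm_apply]
    simp [coordMap_apply]
  refine ⟨g, Subtype.ext (le_antisymm ?_ ?_)⟩
  · rw [Lattice.smul_val]
    rintro _ ⟨x, hx, rfl⟩
    obtain ⟨y, rfl⟩ := mem_stdLattice.1 hx
    change g.1 *ᵥ _ ∈ L.1
    rw [hgc]
    exact (b.equivFun.symm y).2
  · intro x hx
    have := Lattice.mulVec_mem_smul (g := g) (mem_stdLattice.2 ⟨b.equivFun ⟨x, hx⟩, rfl⟩ :
      _ ∈ (stdLattice R F).1)
    rwa [hgc, LinearEquiv.symm_apply_apply] at this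

end StandardLattice
end DrinfeldModular
end

noncomputable section

namespace DrinfeldModular

open Matrix IsLocalRing

/-! ### Determinants, fixed lattices and neighbours -/

section Neighbours

variable {R F : Type*} [CommRing R] [IsDomain R] [IsDiscreteValuationRing R] [Field F]
  [Algebra R F] [IsFractionRing R F]

theorem exists_algebraMap_eq_or_inv (c : F) :
    (∃ r : R, algebraMap R F r = c) ∨ ∃ r : R, algebraMap R F r = c⁻¹ :=
  ValuationRing.isInteger_or_isInteger R c

theorem glMap_smul_stdLattice_le (γ : GeneralLinearGroup (Fin 2) R) :
    (GeneralLinearGroup.map (algebraMap R F) γ • stdLattice R F).1 ≤ (stdLattice R F).1 := by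
  rw [Lattice.smul_val]
  rintro _ ⟨x, hx, rfl⟩
  obtain ⟨y, rfl⟩ := mem_stdLattice.1 hx
  exact mem_stdLattice.2 ⟨γ.1 *ᵥ y, coordMap_mulVec _ _⟩

theorem glMap_smul_stdLattice (γ : GeneralLinearGroup (Fin 2) R) :
    GeneralLinearGroup.map (algebraMap R F) γ • stdLattice R F = stdLattice R F := by
  refine Subtype.ext ((glMap_smul_stdLattice_le γ).antisymm ?_)
  have := Lattice.smul_le_smul (g := GeneralLinearGroup.map (algebraMap R F) γ)
    (glMap_smul_stdLattice_le (F := F) γ⁻¹)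
  rwa [map_inv, smul_inv_smul] at this

theorem exists_map_eq_of_smul_le {D : GeneralLinearGroup (Fin 2) F}
    (h : (D • stdLattice R F).1 ≤ (stdLattice R F).1) :
    ∃ M : Matrix (Fin 2) (Fin 2) R, M.map (algebraMap R F) = D.1 := by
  have : ∀ j, ∃ y : Fin 2 → R, coordMap R F y = D.1 *ᵥ Pi.single j 1 := fun j => by
    refine mem_stdLattice.1 (h (Lattice.mulVec_mem_smul (mem_stdLattice.2 ⟨Pi.single j 1, ?_⟩)))
    ext i
    by_cases hij : i = j
    · subst hij; simp [coordMap_apply]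
    · simp [coordMap_apply, hij]
  choose y hy using this
  refine ⟨fun i j => y j i, ?_⟩
  ext i j
  have := congrFun (hy j) i
  rw [mulVec_single_one] at this
  exact this

theorem smul_stdLattice_eq_of_isUnit_det {D : GeneralLinearGroup (Fin 2) F}
    {M : Matrix (Fin 2) (Fin 2) R} (hM : M.map (algebraMap R F) = D.1) (hd : IsUnit M.det) :
    D • stdLattice R F = stdLattice R F := by
  let γ : GeneralLinearGroup (Fin 2) R := GeneralLinearGroup.mk'' M hd
  have : D = GeneralLinearGroup.map (algebraMap R F) γ := Units.ext hM.symm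
  rw [this, glMap_smul_stdLattice]

theorem exists_glMap_eq_of_smul_eq {h : GeneralLinearGroup (Fin 2) F}
    (hh : h • stdLattice R F = stdLattice R F) :
    ∃ γ : GeneralLinearGroup (Fin 2) R, GeneralLinearGroup.map (algebraMap R F) γ = h := by
  have hh' : h⁻¹ • stdLattice R F = stdLattice R F := inv_smul_eq_iff.2 hh.symm
  obtain ⟨M, hM⟩ := exists_map_eq_of_smul_le (R := R) (D := h) (by rw [hh])
  obtain ⟨N, hN⟩ := exists_map_eq_of_smul_le (R := R) (D := h⁻¹) (by rw [hh'])
  have hinj : Function.Injective fun X : Matrix (Fin 2) (Fin 2) R => X.map (algebraMap R F) :=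
    Matrix.map_injective (IsFractionRing.injective R F)
  have h1 : M * N = 1 := hinj (by
    simp only [Matrix.map_mul]
    rw [hM, hN, ← Units.val_mul, mul_inv_cancel, Units.val_one, Matrix.map_one _ (map_zero _)
      (map_one _)])
  exact ⟨⟨M, N, h1, mul_eq_one_comm.1 h1⟩, Units.ext hM⟩

/-- Here $c^2$ has valuation zero, so $c$ is a unit of $R$; since $R$ is a valuation ring, $c$ or
$c^{-1}$ may be taken in $R$. -/
theorem scalarGL_smul_eq_of_sq {c : Fˣ} {e : R} (he : IsUnit e) {d : R} (hd : IsUnit d)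
    (h : algebraMap R F d = (c : F) ^ 2 * algebraMap R F e) (L : Lattice R F) :
    scalarGL c • L = L := by
  have hinj := IsFractionRing.injective R F
  rcases exists_algebraMap_eq_or_inv (R := R) (c : F) with ⟨r, hr⟩ | ⟨r, hr⟩
  · rw [← hr, ← map_pow, ← map_mul] at h
    have hru : IsUnit r := by
      rw [hinj h] at hd
      exact (isUnit_pow_iff two_ne_zero).1 (isUnit_of_mul_isUnit_left hd)
    obtain ⟨s, hs⟩ := hru.exists_right_inv
    refine scalarGL_smul_eq_of_isUnit hr (s := s) (eq_inv_of_mul_eq_one_right ?_) L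
    rw [← hr, ← map_mul, hs, map_one]
  · have h' : algebraMap R F (r ^ 2 * d) = algebraMap R F e := by
      rw [map_mul, h, map_pow, hr, ← mul_assoc, ← mul_pow, inv_mul_cancel₀ c.ne_zero, one_pow,
        one_mul]
    have hru : IsUnit r := by
      rw [← hinj h'] at he
      exact (isUnit_pow_iff two_ne_zero).1 (isUnit_of_mul_isUnit_left he)
    obtain ⟨s, hs⟩ := hru.exists_left_inv
    refine scalarGL_smul_eq_of_isUnit (r := s) (s := r) ?_ hr L
    have : algebraMap R F s * (c : F)⁻¹ = 1 := by rw [← hr, ← map_mul, hs, map_one]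
    exact (mul_inv_eq_one₀ c.ne_zero).1 this

theorem det_scalarGL_mul (c : Fˣ) (g : GeneralLinearGroup (Fin 2) F) :
    (scalarGL c * g).1.det = (c : F) ^ 2 * g.1.det := by
  rw [Units.val_mul, det_mul, scalarGL_val, det_smul]
  simp

/-- A matrix whose determinant is a unit and which fixes the standard vertex fixes the standard
lattice. -/
theorem smul_stdLattice_eq_of_smul_vertex {h : GeneralLinearGroup (Fin 2) F} {e : R}
    (he : IsUnit e) (hdet : h.1.det = algebraMap R F e)
    (hh : h • Vertex.mk (stdLattice R F) = Vertex.mk (stdLattice R F)) :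
    h • stdLattice R F = stdLattice R F := by
  rw [Vertex.smul_mk, Vertex.mk_eq_mk] at hh
  obtain ⟨c, hc⟩ := hh
  have hc' : (scalarGL c * h) • stdLattice R F = stdLattice R F := by rw [mul_smul, ← hc]
  obtain ⟨γ, hγ⟩ := exists_glMap_eq_of_smul_eq hc'
  have hd : algebraMap R F γ.1.det = (c : F) ^ 2 * algebraMap R F e := by
    rw [← hdet, ← det_scalarGL_mul, ← hγ]
    exact RingHom.map_det _ _
  conv_rhs => rw [hc]
  rw [scalarGL_smul_eq_of_sq he ((isUnit_iff_isUnit_det _).1 γ.isUnit) hd]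

theorem uniformizer_smul_le {ϖ : R} (hϖ : Irreducible ϖ) {c : Fˣ}
    (hc : (c : F) = algebraMap R F ϖ) (u : Fin 2 → ResidueField R) :
    (scalarGL c • stdLattice R F).1 ≤ (lineLattice F u).1 := by
  rw [← map_coordMap_ker_reduction hϖ hc]
  exact Submodule.map_mono (ker_reduction_le_lineModule u)

theorem lineLattice_ne_stdLattice {u : Fin 2 → ResidueField R} (hu : u ≠ 0) :
    lineLattice F u ≠ stdLattice R F := fun h =>
  (lineLattice_covBy (F := F) hu).1.ne (congrArg Subtype.val h)

theorem exists_uniformizer_unit (R F : Type*) [CommRing R] [IsDomain R]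
    [IsDiscreteValuationRing R] [Field F] [Algebra R F] [IsFractionRing R F] :
    ∃ (ϖ : R) (p : Fˣ), Irreducible ϖ ∧ (p : F) = algebraMap R F ϖ := by
  obtain ⟨ϖ, hϖ⟩ := IsDiscreteValuationRing.exists_irreducible R
  exact ⟨ϖ, Units.mk0 (algebraMap R F ϖ) (by simpa using hϖ.ne_zero), hϖ, rfl⟩

/-- A matrix whose determinant is a unit does not map the standard vertex to a neighbour. -/
theorem smul_mk_stdLattice_ne {g : GeneralLinearGroup (Fin 2) F} {e : R}
    (he : IsUnit e) (hdet : g.1.det = algebraMap R F e) {u : Fin 2 → ResidueField R}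
    (hu : u ≠ 0) : g • Vertex.mk (stdLattice R F) ≠ Vertex.mk (lineLattice F u) := by
  intro hg
  rw [Vertex.smul_mk, Vertex.mk_eq_mk] at hg
  obtain ⟨c, hc⟩ := hg
  obtain ⟨ϖ, p, hϖ, hp⟩ := exists_uniformizer_unit R F
  have hinj := IsFractionRing.injective R F
  set D := scalarGL c * g with hD
  rw [← mul_smul, ← hD] at hc
  -- Strictness of $\varpi R^2 \subset DR^2\subset R^2$ makes $M=D$ and $N=\varpi D^{-1}$ integral
  -- with nonunit determinants of product $\varpi^2$, so each has valuation one. But $\det D=c^2\det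
  -- g$ has even valuation.
  obtain ⟨M, hM⟩ := exists_map_eq_of_smul_le (R := R) (D := D) (by
    rw [← hc]; exact lineLattice_le u)
  obtain ⟨N, hN⟩ := exists_map_eq_of_smul_le (R := R) (D := D⁻¹ * scalarGL p) (by
    rw [mul_smul, ← Lattice.smul_le_smul_iff (g := D), smul_inv_smul, ← hc]
    exact uniformizer_smul_le hϖ hp u)
  have hMu : ¬ IsUnit M.det := fun h =>
    lineLattice_ne_stdLattice hu (hc.trans (smul_stdLattice_eq_of_isUnit_det hM h))
  have hNu : ¬ IsUnit N.det := fun h => by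
    have h1 := smul_stdLattice_eq_of_isUnit_det hN h
    rw [mul_smul, inv_smul_eq_iff, ← hc] at h1
    exact (scalarGL_smul_std_covBy_lineLattice hϖ hp hu).1.ne (congrArg Subtype.val h1)
  have hMN : M.det * N.det = ϖ ^ 2 := by
    apply hinj
    rw [map_mul, map_pow, RingHom.map_det, RingHom.map_det, RingHom.mapMatrix_apply,
      RingHom.mapMatrix_apply, hM, hN, ← det_mul, ← Units.val_mul, mul_inv_cancel_left,
      scalarGL_val, det_smul, hp]
    simp
  have hMd : algebraMap R F M.det = (c : F) ^ 2 * algebraMap R F e := by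
    rw [RingHom.map_det, RingHom.mapMatrix_apply, hM, hD, det_scalarGL_mul, hdet]
  rcases exists_algebraMap_eq_or_inv (R := R) (c : F) with ⟨r, hr⟩ | ⟨r, hr⟩
  · rw [← hr, ← map_pow, ← map_mul] at hMd
    have hMd' := hinj hMd
    have hr' : r ∈ maximalIdeal R := (mem_maximalIdeal _).2 fun h =>
      hMu (hMd' ▸ (h.pow 2).mul he)
    rw [hϖ.maximalIdeal_eq, Ideal.mem_span_singleton] at hr'
    obtain ⟨s, rfl⟩ := hr'
    rw [hMd'] at hMN
    have : ϖ ^ 2 * (s ^ 2 * e * N.det) = ϖ ^ 2 * 1 := by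
      linear_combination hMN
    exact hNu (IsUnit.of_mul_eq_one_right _ (mul_left_cancel₀ (pow_ne_zero 2 hϖ.ne_zero) this))
  · have h' : algebraMap R F (r ^ 2 * M.det) = algebraMap R F e := by
      rw [map_mul, hMd, map_pow, hr, ← mul_assoc, ← mul_pow, inv_mul_cancel₀ c.ne_zero, one_pow,
        one_mul]
    rw [← hinj h'] at he
    exact hMu (isUnit_of_mul_isUnit_right he)

/-- If $L'=cL$ with $c=\varpi s$ a nonunit of $R$, then $\varpi R^2\subseteq L'=\varpi sL$ forces
$R^2\subseteq sL\subseteq L$, which is absurd. So the homothety factor is a unit. -/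
theorem mk_lineLattice_eq_mk_lineLattice {u u' : Fin 2 → ResidueField R} (hu : u ≠ 0)
    (hu' : u' ≠ 0) (h : Vertex.mk (lineLattice F u) = Vertex.mk (lineLattice F u')) :
    lineLattice F u = lineLattice F u' := by
  obtain ⟨ϖ, p, hϖ, hp⟩ := exists_uniformizer_unit R F
  have key : ∀ {u u' : Fin 2 → ResidueField R} (_ : u ≠ 0) {c : Fˣ} {r : R}
      (_ : algebraMap R F r = c) (_ : lineLattice F u' = scalarGL c • lineLattice F u),
      lineLattice F u = lineLattice F u' := by
    intro u u' hu c r hr h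
    by_cases hru : IsUnit r
    · obtain ⟨s, hs⟩ := hru.exists_right_inv
      rw [h, scalarGL_smul_eq_of_isUnit hr (s := s) (eq_inv_of_mul_eq_one_right (by
        rw [← hr, ← map_mul, hs, map_one]))]
    · have hr' : r ∈ maximalIdeal R := (mem_maximalIdeal _).2 hru
      rw [hϖ.maximalIdeal_eq, Ideal.mem_span_singleton] at hr'
      obtain ⟨s, rfl⟩ := hr'
      refine absurd (Subtype.ext ((lineLattice_le u).antisymm fun x hx => ?_))
        (lineLattice_ne_stdLattice (F := F) hu)
      have h1 := smul_mem_lineLattice (F := F) hϖ.not_isUnit hx u'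
      rw [h, mem_scalarGL_smul, smul_smul] at h1
      have h2 := (lineLattice F u).1.smul_mem s h1
      rw [← algebraMap_smul F s, smul_smul] at h2
      have : algebraMap R F s * ((c : F)⁻¹ * algebraMap R F ϖ) = 1 := by
        rw [mul_left_comm, ← map_mul, mul_comm s, hr, inv_mul_cancel₀ c.ne_zero]
      rwa [this, one_smul] at h2
  obtain ⟨c, hc⟩ := Vertex.mk_eq_mk.1 h
  rcases exists_algebraMap_eq_or_inv (R := R) (c : F) with ⟨r, hr⟩ | ⟨r, hr⟩
  · exact key hu hr hc
  · refine (key hu' (c := c⁻¹) (r := r) (by rw [hr, Units.val_inv_eq_inv_val]) ?_).symm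
    rw [← scalarGL_inv, hc, inv_smul_smul]

theorem lineLattice_eq_lineLattice_iff {u u' : Fin 2 → ResidueField R} (hu : u ≠ 0) :
    lineLattice F u = lineLattice F u' ↔ ∃ c : ResidueField R, u = c • u' := by
  constructor
  · intro h
    exact eq_smul_of_lineModule_eq (Submodule.map_injective_of_injective coordMap_injective
      (congrArg Subtype.val h))
  · rintro ⟨c, rfl⟩
    have hc : c ≠ 0 := fun h => hu (by rw [h, zero_smul])
    apply Subtype.ext
    change Submodule.map _ _ = Submodule.map _ _
    congr 1
    ext x
    rw [mem_lineModule, mem_lineModule]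
    constructor
    · rintro ⟨d, hd⟩
      exact ⟨d * c, by rw [hd, smul_smul]⟩
    · rintro ⟨d, hd⟩
      exact ⟨d / c, by rw [hd, smul_smul, div_mul_cancel₀ _ hc]⟩

theorem glMap_smul_lineLattice (γ : GeneralLinearGroup (Fin 2) R) (u : Fin 2 → ResidueField R) :
    GeneralLinearGroup.map (algebraMap R F) γ • lineLattice F u =
      lineLattice F (γ.1.map (residue R) *ᵥ u) := by
  have key : ∀ (γ : GeneralLinearGroup (Fin 2) R) (u : Fin 2 → ResidueField R),
      (GeneralLinearGroup.map (algebraMap R F) γ • lineLattice F u).1 ≤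
        (lineLattice F (γ.1.map (residue R) *ᵥ u)).1 := by
    intro γ u
    rw [Lattice.smul_val]
    rintro _ ⟨x, ⟨y, hy, rfl⟩, rfl⟩
    exact ⟨γ.1 *ᵥ y, mulVec_mem_lineModule _ hy, coordMap_mulVec _ _⟩
  refine Subtype.ext ((key γ u).antisymm ?_)
  have := Lattice.smul_le_smul (g := GeneralLinearGroup.map (algebraMap R F) γ)
    (key γ⁻¹ (γ.1.map (residue R) *ᵥ u))
  have hγ : γ⁻¹.1.map (residue R) *ᵥ (γ.1.map (residue R) *ᵥ u) = u :=
    GL_inv_mulVec_mulVec (GeneralLinearGroup.map (residue R) γ) u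
  rwa [map_inv, smul_inv_smul, hγ] at this

/-- The neighbours of the standard vertex. -/
theorem adj_stdLattice_iff {w : Vertex R F} :
    (tree R F).Adj (Vertex.mk (stdLattice R F)) w ↔
      ∃ u : Fin 2 → ResidueField R, u ≠ 0 ∧ w = Vertex.mk (lineLattice F u) := by
  rw [tree, SimpleGraph.fromRel_adj]
  constructor
  · rintro ⟨-, ⟨L₁, L₂, h1, rfl, h⟩ | ⟨L₁, L₂, rfl, h2, h⟩⟩
    · obtain ⟨c, hc⟩ := Vertex.mk_eq_mk.1 h1
      have := Lattice.smul_covBy_smul (g := scalarGL c) h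
      rw [← hc] at this
      obtain ⟨u, hu, hL⟩ := exists_eq_lineLattice_of_covBy this
      exact ⟨u, hu, by rw [← hL, Vertex.mk_scalarGL_smul]⟩
    -- When the neighbour $L_1$ lies above the standard lattice, $\varpi L_1$ is maximal below it:
    -- write $L_1=DR^2$ and transport the chain $\varpi R^2\subset L_u\subset R^2$ by $D$.
    · obtain ⟨c, hc⟩ := Vertex.mk_eq_mk.1 h2
      have h3 := Lattice.smul_covBy_smul (g := scalarGL c) h
      rw [← hc] at h3
      obtain ⟨D, hD⟩ := exists_smul_stdLattice_eq (R := R) (scalarGL c • L₁)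
      have h4 := Lattice.smul_covBy_smul (g := D⁻¹) h3
      rw [← hD, inv_smul_smul] at h4
      obtain ⟨u, hu, hL⟩ := exists_eq_lineLattice_of_covBy h4
      obtain ⟨ϖ, p, hϖ, hp⟩ := exists_uniformizer_unit R F
      have h5 := Lattice.smul_covBy_smul (g := D)
        (scalarGL_smul_std_covBy_lineLattice hϖ hp hu)
      rw [← hL, smul_inv_smul, ← mul_smul, scalarGL_mul_comm, mul_smul, hD] at h5
      obtain ⟨u', hu', hL'⟩ := exists_eq_lineLattice_of_covBy h5
      exact ⟨u', hu', by rw [← hL', Vertex.mk_scalarGL_smul, Vertex.mk_scalarGL_smul]⟩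
  · rintro ⟨u, hu, rfl⟩
    refine ⟨?_, Or.inl ⟨_, _, rfl, rfl, lineLattice_covBy hu⟩⟩
    have := smul_mk_stdLattice_ne (F := F) (g := 1) (e := (1 : R)) isUnit_one (by simp) hu
    rwa [one_smul] at this

end Neighbours

/-! ### Isolated vertices of quotient graphs -/

section QuotientGraph

variable {G V : Type*} [Group G] [MulAction G V]

theorem edgeOrbit_smul (g : G) (v w : V) : edgeOrbit G (g • v) (g • w) = edgeOrbit G v w := by
  ext e
  constructor
  · rintro ⟨h, rfl⟩
    exact ⟨h * g, by simp [mul_smul]⟩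
  · rintro ⟨h, rfl⟩
    exact ⟨h * g⁻¹, by simp [mul_smul]⟩

/-- As $v$ is not adjacent to its own orbit, an element carrying one edge at $v$ to another cannot
swap the roles of the endpoints, so it fixes $v$. Edges at the image of $v$ are thus the stabilizer
orbits of neighbours. -/
theorem isIsolated_quotientGraph_iff {T : SimpleGraph V}
    (hT : ∀ (g : G) {v w : V}, T.Adj v w → T.Adj (g • v) (g • w)) {v : V}
    (hne : ∀ g : G, ¬ T.Adj v (g • v)) (hex : ∃ w, T.Adj v w) :
    IsIsolated (quotientGraph G T) (Quotient.mk _ v) ↔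
      ∀ w w', T.Adj v w → T.Adj v w' → ∃ g ∈ MulAction.stabilizer G v, g • w = w' := by
  have hinc : ∀ E, (quotientGraph G T).Inc E (Quotient.mk _ v) ↔
      ∃ w, T.Adj v w ∧ E = edgeOrbit G v w := by
    intro E
    constructor
    · rintro ⟨_, v', w, hvw, rfl, hv', -⟩
      obtain ⟨g, rfl⟩ := (Quotient.exact hv' : MulAction.orbitRel G V v' v)
      refine ⟨g⁻¹ • w, ?_, ?_⟩
      · simpa using hT g⁻¹ hvw
      · rw [← edgeOrbit_smul g v, smul_inv_smul]
    · rintro ⟨w, hw, rfl⟩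
      exact ⟨_, v, w, hw, rfl, rfl, rfl⟩
  have heq : ∀ w w', T.Adj v w → (edgeOrbit G v w = edgeOrbit G v w' ↔
      ∃ g ∈ MulAction.stabilizer G v, g • w = w') := by
    intro w w' hw
    constructor
    · intro h
      have : s(v, w') ∈ edgeOrbit G v w := h ▸ ⟨1, by simp⟩
      obtain ⟨g, hg⟩ := this
      rcases Sym2.eq_iff.1 hg with ⟨h1, h2⟩ | ⟨-, h2⟩
      · exact ⟨g, h1, h2⟩
      · exact absurd hw (by rw [← inv_smul_eq_iff.2 h2.symm]; exact hne _)
    · rintro ⟨g, hg, rfl⟩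
      rw [← edgeOrbit_smul g v w, MulAction.mem_stabilizer_iff.1 hg]
  constructor
  · rintro ⟨E, -, hE⟩ w w' hw hw'
    rw [← heq w w' hw, hE _ ((hinc _).2 ⟨w, hw, rfl⟩), hE _ ((hinc _).2 ⟨w', hw', rfl⟩)]
  · intro h
    obtain ⟨w, hw⟩ := hex
    refine ⟨_, (hinc _).2 ⟨w, hw, rfl⟩, fun E hE => ?_⟩
    obtain ⟨w', hw', rfl⟩ := (hinc _).1 hE
    exact (heq w' w hw').2 (h w' w hw' hw)

end QuotientGraph
end DrinfeldModular
end

noncomputable section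

namespace DrinfeldModular

open Polynomial IntermediateField
open scoped algebraAdjoinAdjoin

/-! ### Places of function fields -/

section FunctionField

variable {k K : Type*} [Field k] [Field K] [Algebra k K]

/-- Exchange in transcendence degree one: $y$ is algebraic over $k(x)$, hence $x$ over $k(y)$, and
$K$ is finite over $k(x,y)$. -/
theorem finiteDimensional_adjoin_of_transcendental {x y : K} (hx : Transcendental k x)
    (hfin : FiniteDimensional k⟮x⟯ K) (hy : Transcendental k y) : FiniteDimensional k⟮y⟯ K := by
  have hxy : IsAlgebraic k⟮y⟯ x :=
    isAlgebraic_adjoin_iff.mpr (.adjoin_singleton hx hy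
      (isAlgebraic_adjoin_iff.mp (Algebra.IsAlgebraic.isAlgebraic y)))
  let Fyx := restrictScalars k k⟮y⟯⟮x⟯
  let Fxy := restrictScalars k k⟮x⟯⟮y⟯
  let : Algebra k⟮y⟯ Fyx := k⟮y⟯⟮x⟯.algebra
  let : Module k⟮y⟯ Fyx := Algebra.toModule
  let : SMul k⟮y⟯ Fyx := Algebra.toSMul
  let : Algebra k⟮x⟯ Fxy := k⟮x⟯⟮y⟯.algebra
  let : Module k⟮x⟯ Fxy := Algebra.toModule
  let : SMul k⟮x⟯ Fxy := Algebra.toSMul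
  have : FiniteDimensional k⟮y⟯ Fyx :=
    adjoin.finiteDimensional (isAlgebraic_iff_isIntegral.mp hxy)
  have : FiniteDimensional Fyx K := by
    unfold Fyx
    rw [adjoin_simple_comm]
    have : IsScalarTower k⟮x⟯ Fxy K := isScalarTower_mid' k⟮x⟯⟮y⟯
    exact .right k⟮x⟯ Fxy K
  have : IsScalarTower k⟮y⟯ Fyx K := isScalarTower_mid' k⟮y⟯⟮x⟯
  exact .trans k⟮y⟯ Fyx K

/-- Since $k$ is algebraically closed in $K$, it is integrally closed there, so any $x\notin k$ is
avoided by some valuation ring containing $k$. That ring is proper, hence a place. -/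
theorem mem_range_of_forall_place (hK : IsFunctionField k K) {x : K}
    (hx : ∀ Q : Place k K, x ∈ Q.ring) : x ∈ (algebraMap k K).range := by
  by_contra hxk
  have : IsIntegrallyClosedIn (algebraMap k K).range K := by
    rw [Subring.isIntegrallyClosedIn_iff]
    rintro y ⟨p, hp, hpy⟩
    refine hK.mem_range_of_isAlgebraic y ?_
    obtain ⟨p', hp'⟩ := map_surjective _ (algebraMap k K).rangeRestrict_surjective p
    refine ⟨p', ?_, ?_⟩
    · rintro rfl
      rw [Polynomial.map_zero] at hp'
      exact hp.ne_zero hp'.symm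
    · rw [← hp', eval₂_map] at hpy
      exact hpy
  obtain ⟨V, hV, hxV⟩ := Subring.exists_le_valuationSubring_of_isIntegrallyClosedIn hxk
  exact hxV (hx ⟨V, fun c => hV ⟨c, rfl⟩, fun h => hxV (h ▸ ValuationSubring.mem_top x)⟩)

namespace Place

variable (P : Place k K)

instance : IsScalarTower k P.ring K := IsScalarTower.of_algebraMap_eq fun _ => rfl

theorem mem_range_of_mem (hK : IsFunctionField k K) {x : K} (hx : x ∈ P.integralOutside)
    (hxP : x ∈ P.ring) : x ∈ (algebraMap k K).range := by
  refine mem_range_of_forall_place hK fun Q => ?_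
  by_cases h : Q = P
  · rwa [h]
  · exact (Subring.mem_iInf.1 hx) ⟨Q, h⟩

theorem algebraMap_mem_integralOutside (c : k) : algebraMap k K c ∈ P.integralOutside :=
  Subring.mem_iInf.2 fun Q => Q.1.algebraMap_mem c

theorem coeff_zero_eq_zero {y : P.ring} {ι : Type*} {z : ι → P.ring}
    (hz : LinearIndependent k fun i => Ideal.Quotient.mk (Ideal.span {y}) (z i))
    {s : Finset ι} {p : ι → k[X]} (h : ∑ i ∈ s, aeval y (p i) * z i = 0) :
    ∀ i ∈ s, (p i).coeff 0 = 0 := by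
  refine linearIndependent_iff'.1 hz s _ ?_
  have h' := congrArg (Ideal.Quotient.mk (Ideal.span {y})) h
  rw [map_sum, map_zero] at h'
  rw [← h']
  refine Finset.sum_congr rfl fun i _ => ?_
  have hy : Ideal.Quotient.mk (Ideal.span {y}) y = 0 :=
    Ideal.Quotient.eq_zero_iff_mem.2 (Ideal.mem_span_singleton_self y)
  conv_rhs => rw [← divX_mul_X_add (p i)]
  rw [map_mul, map_add, map_mul, aeval_X, aeval_C, map_add, map_mul, hy, mul_zero, zero_add,
    Algebra.smul_def]
  rfl

/-- Given a relation with coefficients in $k[y]$, reduction modulo $y$ kills the constant terms.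
Dividing by $y$ and repeating, every coefficient is divisible by all powers of $y$, hence zero. -/
theorem linearIndependent_adjoin {y : P.ring} (hy : Transcendental k (y : K)) {ι : Type*}
    {z : ι → P.ring}
    (hz : LinearIndependent k fun i => Ideal.Quotient.mk (Ideal.span {y}) (z i)) :
    LinearIndependent k⟮(y : K)⟯ fun i => (z i : K) := by
  have hy0 : y ≠ 0 := by
    rintro rfl
    exact hy (isAlgebraic_zero)
  have key : ∀ (n : ℕ) (s : Finset ι) (p : ι → k[X]), ∑ i ∈ s, aeval y (p i) * z i = 0 →
      ∀ i ∈ s, X ^ n ∣ p i := by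
    intro n
    induction n with
    | zero => intro s p _ i _; simp
    | succ n ih =>
      intro s p hp i hi
      have h0 := coeff_zero_eq_zero P hz hp
      have hX : ∀ i ∈ s, p i = divX (p i) * X := fun i hi => by
        conv_lhs => rw [← divX_mul_X_add (p i), h0 i hi, C_0, add_zero]
      have h1 : ∑ i ∈ s, aeval y (divX (p i)) * z i = 0 := by
        refine (mul_eq_zero.1 (?_ : y * _ = 0)).resolve_left hy0
        rw [Finset.mul_sum, ← hp]
        refine Finset.sum_congr rfl fun i hi => ?_
        conv_rhs => rw [hX i hi]
        rw [map_mul, aeval_X]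
        ring
      rw [hX i hi, pow_succ]
      exact mul_dvd_mul_right (ih s _ h1 i hi) X
  rw [← LinearIndependent.iff_fractionRing (R := Algebra.adjoin k {(y : K)}), linearIndependent_iff']
  intro s g hg i hi
  have hg' : ∀ i, ∃ p : k[X], aeval (y : K) p = (g i : K) := fun i => by
    exact (Algebra.adjoin_singleton_eq_range_aeval k (y : K)).le (g i).2
  choose p hp using hg'
  have hp' : ∑ i ∈ s, aeval y (p i) * z i = 0 := by
    apply Subtype.ext
    refine Eq.trans ?_ hg
    have : ∀ q : k[X], ((aeval y q : P.ring) : K) = aeval (y : K) q := fun q =>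
      (aeval_algebraMap_apply K y q).symm
    push_cast
    refine Finset.sum_congr rfl fun i _ => ?_
    rw [this, hp]
    rfl
  have hpi : p i = 0 := by
    by_contra hne
    have := natDegree_le_of_dvd (key ((p i).natDegree + 1) s p hp' i hi) hne
    rw [natDegree_X_pow] at this
    omega
  apply Subtype.ext
  rw [← hp i, hpi, map_zero]
  rfl

theorem transcendental_of_not_isUnit (hK : IsFunctionField k K) {y : P.ring} (hy0 : y ≠ 0)
    (hy : ¬ IsUnit y) : Transcendental k (y : K) := by
  intro hal
  obtain ⟨c, hc⟩ := hK.mem_range_of_isAlgebraic _ hal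
  have hyc : algebraMap k P.ring c = y := Subtype.ext hc
  have hc0 : c ≠ 0 := by
    rintro rfl
    exact hy0 (by rw [← hyc, map_zero])
  exact hy (hyc ▸ (IsUnit.mk0 c hc0).map (algebraMap k P.ring))

/-- A nonunit $y\ne0$ is transcendental and $K$ is finite over $k(y)$. Lifting a $k$-basis of the
quotient gives $k(y)$-independent elements, so the quotient has finite dimension. -/
theorem finite_quotient_span (hK : IsFunctionField k K) [Finite k] {y : P.ring} (hy0 : y ≠ 0) :
    Finite (P.ring ⧸ Ideal.span {y}) := by
  by_cases hy : IsUnit y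
  · rw [Ideal.span_singleton_eq_top.2 hy]
    have : Subsingleton (P.ring ⧸ (⊤ : Ideal P.ring)) := Ideal.Quotient.subsingleton_iff.2 rfl
    infer_instance
  · have htr := P.transcendental_of_not_isUnit hK hy0 hy
    obtain ⟨x, hx, hfin⟩ := hK.exists_finite
    have := finiteDimensional_adjoin_of_transcendental hx hfin htr
    let b := Module.Basis.ofVectorSpace k (P.ring ⧸ Ideal.span {y})
    choose z hz using fun i => Ideal.Quotient.mk_surjective (b i)
    have hli := P.linearIndependent_adjoin htr (z := z) (by
      simp only [hz]; exact b.linearIndependent)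
    have := hli.finite
    have := Module.Finite.of_basis b
    exact Module.finite_of_finite k

theorem exists_mem_ne_zero_not_isUnit : ∃ y : P.ring, y ≠ 0 ∧ ¬ IsUnit y := by
  obtain ⟨x, hx⟩ : ∃ x, x ∉ P.ring := by
    by_contra! h
    exact P.ne_top (top_le_iff.1 fun x _ => h x)
  have hx0 : x ≠ 0 := fun h => hx (h ▸ P.ring.zero_mem)
  refine ⟨⟨x⁻¹, (P.ring.mem_or_inv_mem x).resolve_left hx⟩, ?_, ?_⟩
  · intro h
    exact inv_ne_zero hx0 (congrArg Subtype.val h)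
  · intro h
    obtain ⟨z, hz⟩ := h.exists_right_inv
    have : (z : K) = x := by
      have := congrArg Subtype.val hz
      exact (inv_mul_eq_one₀ hx0).1 this |>.symm
    exact hx (this ▸ z.2)

/-- Finite quotients by principal ideals make the ring noetherian, and a noetherian Bézout domain is
principal. -/
theorem isDiscreteValuationRing (hK : IsFunctionField k K) [Finite k] :
    IsDiscreteValuationRing P.ring := by
  have : IsNoetherianRing P.ring := by
    refine ⟨fun I => ?_⟩
    by_cases hI : I = ⊥
    · rw [hI]; exact Submodule.fg_bot
    · obtain ⟨y, hyI, hy0⟩ := Submodule.exists_mem_ne_zero_of_ne_bot hI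
      have := P.finite_quotient_span hK hy0
      refine Submodule.fg_of_fg_map_of_fg_inf_ker (Submodule.mkQ (Ideal.span {y})) ?_ ?_
      · exact Submodule.FG.of_finite
      · rw [Submodule.ker_mkQ, inf_eq_right.2 ((Ideal.span_singleton_le_iff_mem I).2 hyI)]
        exact ⟨{y}, by simp⟩
  have : IsPrincipalIdealRing P.ring := IsPrincipalIdealRing.of_isNoetherianRing_of_isBezout
  refine { not_a_field' := ?_ }
  obtain ⟨y, hy0, hy⟩ := P.exists_mem_ne_zero_not_isUnit
  intro h
  exact hy0 (by simpa [h] using (IsLocalRing.mem_maximalIdeal y).2 hy)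

theorem finite_residueField (hK : IsFunctionField k K) [Finite k] :
    Finite (IsLocalRing.ResidueField P.ring) := by
  obtain ⟨y, hy0, hy⟩ := P.exists_mem_ne_zero_not_isUnit
  have := P.finite_quotient_span hK hy0
  have hle : Ideal.span {y} ≤ IsLocalRing.maximalIdeal P.ring :=
    (Ideal.span_singleton_le_iff_mem _).2 ((IsLocalRing.mem_maximalIdeal y).2 hy)
  exact Finite.of_surjective (Ideal.Quotient.factor hle) (Ideal.Quotient.factor_surjective hle)

/-- The elements of `A` with a bounded pole at the place form a finite set. -/
theorem finite_setOf_mul_mem (hK : IsFunctionField k K) [Finite k] {c : K} (hc : c ∈ P.ring)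
    (hc0 : c ≠ 0) : {x : K | x ∈ P.integralOutside ∧ c * x ∈ P.ring}.Finite := by
  classical
  let y : P.ring := ⟨c, hc⟩
  have := P.finite_quotient_span hK (y := y) fun h => hc0 (congrArg Subtype.val h)
  -- Two elements of the set with equal class of $cx$ modulo $c$ differ by an element of $A$
  -- integral at $P$, hence by a constant. So all fibres are finite; the value $0$ outside is never
  -- used.
  let f : K → P.ring ⧸ Ideal.span {y} := fun x =>
    if h : c * x ∈ P.ring then Ideal.Quotient.mk _ ⟨c * x, h⟩ else 0
  refine Set.Finite.of_finite_fibers f (Set.toFinite _) ?_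
  rintro _ ⟨x, ⟨hxA, hxP⟩, rfl⟩
  refine (Set.finite_range fun d : k => x + algebraMap k K d).subset ?_
  rintro z ⟨⟨hzA, hzP⟩, hzx⟩
  change f z = f x at hzx
  simp only [f, hzP, hxP, dif_pos] at hzx
  rw [Ideal.Quotient.eq, Ideal.mem_span_singleton] at hzx
  obtain ⟨w, hw⟩ := hzx
  have hw' : c * z - c * x = c * w := congrArg Subtype.val hw
  have hzw : z - x = w := mul_left_cancel₀ hc0 (by rw [mul_sub, hw'])
  obtain ⟨d, hd⟩ := P.mem_range_of_mem hK (P.integralOutside.sub_mem hzA hxA) (hzw ▸ w.2)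
  exact ⟨d, by simp [hd]⟩

/-- The units of `A` are constants. -/
theorem exists_eq_of_mul_eq_one (hK : IsFunctionField k K) {x y : K} (hx : x ∈ P.integralOutside)
    (hy : y ∈ P.integralOutside) (hxy : x * y = 1) : ∃ c : k, c ≠ 0 ∧ algebraMap k K c = x := by
  have hx0 : x ≠ 0 := left_ne_zero_of_mul_eq_one hxy
  have key : x ∈ (algebraMap k K).range := by
    -- Either $x$ or its inverse $y$ is integral at $P$ too, hence everywhere, hence constant.
    rcases P.ring.mem_or_inv_mem x with h | h
    · exact P.mem_range_of_mem hK hx h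
    · rw [← eq_inv_of_mul_eq_one_right hxy] at h
      obtain ⟨c, hc⟩ := P.mem_range_of_mem hK hy h
      refine ⟨c⁻¹, ?_⟩
      rw [map_inv₀, hc, ← eq_inv_of_mul_eq_one_left hxy]
  obtain ⟨c, hc⟩ := key
  exact ⟨c, fun h => hx0 (by rw [← hc, h, map_zero]), hc⟩

end Place

end FunctionField
end DrinfeldModular
end

noncomputable section

namespace DrinfeldModular

open IsLocalRing

/-! ### The completion at a place -/

namespace Place

variable {k K : Type*} [Field k] [Field K] [Algebra k K] (P : Place k K)

theorem valued_toCompletion (x : K) :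
    (Valued.v (P.toCompletion x) : P.ring.ValueGroup) = P.ring.valuation x :=
  Valued.valuedCompletion_apply _

theorem mem_completionRing_iff {z : P.Completion} :
    z ∈ P.completionRing ↔ (Valued.v z : P.ring.ValueGroup) ≤ 1 := Iff.rfl

theorem toCompletion_mem_iff {x : K} : P.toCompletion x ∈ P.completionRing ↔ x ∈ P.ring := by
  rw [mem_completionRing_iff, valued_toCompletion, ValuationSubring.valuation_le_one_iff]

theorem exists_valued_eq (z : P.Completion) :
    ∃ x : K, (Valued.v z : P.ring.ValueGroup) = P.ring.valuation x := by
  obtain ⟨r, hr⟩ := Valued.exists_coe_eq_v z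
  exact ⟨r.ofVal, hr⟩

theorem exists_valued_sub_lt_one (z : P.Completion) :
    ∃ x : K, (Valued.v (z - P.toCompletion x) : P.ring.ValueGroup) < 1 := by
  have h : {w : P.Completion | (Valued.v (z - w) : P.ring.ValueGroup) < 1} ∈ nhds z := by
    rw [Valued.mem_nhds]
    refine ⟨1, fun w hw => ?_⟩
    have hw' : Valued.v.restrict (w - z) < 1 := hw
    rw [Valuation.restrict_lt_one_iff] at hw'
    rwa [Set.mem_ofPred_eq, ← Valuation.map_neg, neg_sub]
  obtain ⟨_, ⟨x, rfl⟩, hw⟩ :=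
    UniformSpace.Completion.denseRange_coe.inter_nhds_nonempty h
  exact ⟨x.ofVal, hw⟩

theorem isUnit_completionRing_iff {z : P.completionRing} :
    IsUnit z ↔ (Valued.v (z : P.Completion) : P.ring.ValueGroup) = 1 :=
  (Valuation.valuationSubring.integers _).isUnit_iff_valuation_eq_one

theorem isUnit_ring_iff {x : P.ring} : IsUnit x ↔ P.ring.valuation (x : K) = 1 :=
  P.ring.valuation_eq_one_iff x

/-- The embedding of the valuation ring of the place into `𝒪_∞`. -/
def ringToCompletionRing : P.ring →+* P.completionRing :=
  (P.toCompletion.comp P.ring.subtype).codRestrict P.completionRing.toSubring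
    fun x => P.toCompletion_mem_iff.2 x.2

theorem ringToCompletionRing_val (x : P.ring) :
    (P.ringToCompletionRing x : P.Completion) = P.toCompletion x := rfl

instance : IsLocalHom P.ringToCompletionRing where
  map_nonunit x hx := by
    rw [isUnit_completionRing_iff, ringToCompletionRing_val, valued_toCompletion] at hx
    exact P.isUnit_ring_iff.2 hx

/-- Every value on the completion is attained on $K$, so a uniformizer of the place stays
irreducible and each nonzero integral element is a unit times one of its powers. -/
theorem isDiscreteValuationRing_completionRing [IsDiscreteValuationRing P.ring] :
    IsDiscreteValuationRing P.completionRing := by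
  obtain ⟨ϖ, hϖ⟩ := IsDiscreteValuationRing.exists_irreducible P.ring
  have hlift : ∀ z : P.completionRing, ∃ x : P.ring,
      (Valued.v (z : P.Completion) : P.ring.ValueGroup) = P.ring.valuation (x : K) := by
    intro z
    obtain ⟨x, hx⟩ := P.exists_valued_eq (z : P.Completion)
    exact ⟨⟨x, (P.ring.valuation_le_one_iff x).1 (hx ▸ z.2)⟩, hx⟩
  have hunit : ∀ (z : P.completionRing) (x : P.ring),
      (Valued.v (z : P.Completion) : P.ring.ValueGroup) = P.ring.valuation (x : K) →
      (IsUnit z ↔ IsUnit x) := fun z x h => by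
    rw [isUnit_completionRing_iff, isUnit_ring_iff, h]
  have hassoc : ∀ x y : P.ring, P.ring.valuation (x : K) = P.ring.valuation (y : K) →
      Associated x y := by
    intro x y h
    exact ((P.ring.valuation_eq_iff (x : K) y).1 h).elim fun u hu =>
      Associated.symm ⟨u, Subtype.ext (by rw [mul_comm]; exact hu)⟩
  apply IsDiscreteValuationRing.ofHasUnitMulPowIrreducibleFactorization
  refine ⟨P.ringToCompletionRing ϖ, ⟨?_, ?_⟩, ?_⟩
  · exact fun h => hϖ.not_isUnit (isUnit_of_map_unit P.ringToCompletionRing ϖ h)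
  · intro a b hab
    obtain ⟨x, hx⟩ := hlift a
    obtain ⟨y, hy⟩ := hlift b
    rw [hunit a x hx, hunit b y hy]
    have hv : P.ring.valuation (ϖ : K) = P.ring.valuation ((x * y : P.ring) : K) := by
      rw [← valued_toCompletion, ← ringToCompletionRing_val, hab]
      push_cast
      rw [map_mul, map_mul, hx, hy]
    exact ((hassoc _ _ hv).irreducible hϖ).isUnit_or_isUnit rfl
  · intro z hz
    obtain ⟨x, hx⟩ := hlift z
    have hx0 : x ≠ 0 := by
      rintro rfl
      apply hz
      rw [ZeroMemClass.coe_zero, map_zero, map_eq_zero] at hx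
      exact Subtype.ext hx
    obtain ⟨n, hn⟩ := IsDiscreteValuationRing.associated_pow_irreducible hx0 hϖ
    refine ⟨n, ?_⟩
    obtain ⟨u, hu⟩ := hn
    have hvu : P.ring.valuation ((u : P.ring) : K) = 1 := P.isUnit_ring_iff.1 u.isUnit
    have hvz : (Valued.v ((P.ringToCompletionRing ϖ ^ n : P.completionRing) : P.Completion) :
        P.ring.ValueGroup) = Valued.v (z : P.Completion) := by
      rw [hx, ← map_pow, ← hu, ringToCompletionRing_val, valued_toCompletion]
      push_cast
      rw [map_mul, hvu, mul_one]
    have hne : ((P.ringToCompletionRing ϖ ^ n : P.completionRing) : P.Completion) ≠ 0 := by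
      intro h
      rw [h, map_zero, eq_comm, map_eq_zero] at hvz
      exact hz (Subtype.ext hvz)
    have hvz0 : (Valued.v (z : P.Completion) : P.ring.ValueGroup) ≠ 0 := by
      rw [Ne, map_eq_zero]
      exact fun h => hz (Subtype.ext h)
    have hmem : (z : P.Completion) / ((P.ringToCompletionRing ϖ ^ n : P.completionRing) :
        P.Completion) ∈ P.completionRing := by
      rw [mem_completionRing_iff, map_div₀, hvz, div_self hvz0]
    have hu' : IsUnit (⟨_, hmem⟩ : P.completionRing) := by
      rw [isUnit_completionRing_iff]
      change Valued.v (_ / _) = _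
      rw [map_div₀, hvz, div_self hvz0]
    obtain ⟨w, hw⟩ := hu'
    refine ⟨w, Subtype.ext ?_⟩
    rw [hw, MulMemClass.coe_mul, mul_div_cancel₀ _ hne]

instance : Algebra k P.completionRing :=
  (P.ringToCompletionRing.comp (algebraMap k P.ring)).toAlgebra

theorem residueField_map_surjective :
    Function.Surjective (ResidueField.map P.ringToCompletionRing) := by
  intro z
  obtain ⟨z, rfl⟩ := residue_surjective z
  obtain ⟨x, hx⟩ := P.exists_valued_sub_lt_one (z : P.Completion)
  have hxP : x ∈ P.ring := by
    rw [← toCompletion_mem_iff, ← sub_sub_cancel (z : P.Completion) (P.toCompletion x)]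
    exact P.completionRing.sub_mem z.2 (P.mem_completionRing_iff.2 hx.le)
  refine ⟨residue _ ⟨x, hxP⟩, ?_⟩
  rw [ResidueField.map_residue, eq_comm, ← sub_eq_zero, ← map_sub, residue_eq_zero_iff,
    mem_maximalIdeal, mem_nonunits_iff, isUnit_completionRing_iff]
  exact hx.ne

theorem finrank_residueField_completionRing :
    Module.finrank k (ResidueField P.completionRing) = P.degree := by
  let f : ResidueField P.ring →ₐ[k] ResidueField P.completionRing :=
    { ResidueField.map P.ringToCompletionRing with
      commutes' := fun c => rfl }
  exact (LinearEquiv.ofBijective f.toLinearMap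
    ⟨(ResidueField.map P.ringToCompletionRing).injective,
      P.residueField_map_surjective⟩).finrank_eq.symm

theorem finite_residueField_completionRing (hK : IsFunctionField k K) [Finite k] :
    Finite (ResidueField P.completionRing) := by
  have := P.finite_residueField hK
  exact Finite.of_surjective _ P.residueField_map_surjective

/-- The common denominator is found in $K$ rather than $K_\infty$, so that it can bound poles of
elements of $A$. -/
theorem exists_mul_mem_completionRing {ι : Type*} [Finite ι] (z : ι → P.Completion) :
    ∃ c ∈ P.ring, c ≠ 0 ∧ ∀ i, P.toCompletion c * z i ∈ P.completionRing := by
  have := Fintype.ofFinite ι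
  classical
  have h1 : ∀ w : P.Completion, ∃ c : P.ring, (c : K) ≠ 0 ∧
      P.toCompletion c * w ∈ P.completionRing := by
    intro w
    obtain ⟨x, hx⟩ := P.exists_valued_eq w
    rcases P.ring.mem_or_inv_mem x with h | h
    · exact ⟨1, one_ne_zero, by simpa [mem_completionRing_iff, hx] using h⟩
    · by_cases hx0 : x = 0
      · refine ⟨1, one_ne_zero, ?_⟩
        simp [hx, hx0]
      · refine ⟨⟨x⁻¹, h⟩, inv_ne_zero hx0, ?_⟩
        rw [mem_completionRing_iff, map_mul, hx, valued_toCompletion, ← map_mul,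
          inv_mul_cancel₀ hx0, map_one]
  choose c hc0 hc using fun i => h1 (z i)
  refine ⟨((∏ i, c i : P.ring) : K), (∏ i, c i : P.ring).2, ?_, fun i => ?_⟩
  · push_cast
    exact Finset.prod_ne_zero_iff.2 fun i _ => hc0 i
  · rw [← Finset.mul_prod_erase _ _ (Finset.mem_univ i), mul_comm (c i)]
    push_cast
    rw [map_mul, mul_assoc]
    refine P.completionRing.mul_mem _ _ ?_ (hc i)
    rw [toCompletion_mem_iff]
    exact_mod_cast (∏ j ∈ Finset.univ.erase i, c j : P.ring).2

end Place
end DrinfeldModular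
end

noncomputable section

namespace DrinfeldModular

open Matrix IsLocalRing

/-! ### Stabilizers as unit groups of finite algebras -/

namespace Place

variable {k K : Type*} [Field k] [Field K] [Algebra k K] (P : Place k K)

section Conj

variable (B : GeneralLinearGroup (Fin 2) P.Completion)

/-- The map `M ↦ B⁻¹ M B` from matrices over `K` to matrices over `K_∞`. -/
def conj : Matrix (Fin 2) (Fin 2) K →+* Matrix (Fin 2) (Fin 2) P.Completion where
  toFun M := B⁻¹.1 * P.toCompletion.mapMatrix M * B.1
  map_one' := by rw [map_one, mul_one, ← Units.val_mul, inv_mul_cancel, Units.val_one]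
  map_zero' := by rw [map_zero, mul_zero, zero_mul]
  map_add' M N := by rw [map_add, mul_add, add_mul]
  map_mul' M N := by
    rw [map_mul, mul_assoc _ _ B.1, mul_assoc _ B.1, ← mul_assoc B.1, ← mul_assoc B.1,
      ← Units.val_mul, mul_inv_cancel, Units.val_one, one_mul]
    simp only [mul_assoc]

theorem conj_apply (M : Matrix (Fin 2) (Fin 2) K) :
    P.conj B M = B⁻¹.1 * P.toCompletion.mapMatrix M * B.1 := rfl

theorem conj_algebraMap (c : k) : P.conj B (algebraMap k _ c) =
    (algebraMap P.completionRing P.Completion).mapMatrix (algebraMap k _ c) := by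
  have h1 : P.toCompletion.mapMatrix (algebraMap k _ c) =
      Matrix.scalar (Fin 2) (P.toCompletion (algebraMap k K c)) := by
    ext i j
    simp [Matrix.algebraMap_matrix_apply, Matrix.diagonal_apply, apply_ite P.toCompletion]
  have h2 : (algebraMap P.completionRing P.Completion).mapMatrix (algebraMap k _ c) =
      Matrix.scalar (Fin 2) (P.toCompletion (algebraMap k K c)) := by
    ext i j
    by_cases h : i = j
    · subst h; simp [Matrix.algebraMap_matrix_apply]; rfl
    · simp [Matrix.algebraMap_matrix_apply, h]
  rw [conj_apply, h1, h2, mul_assoc,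
    (Matrix.scalar_commute _ (fun _ => Commute.all _ _) B.1).eq, ← mul_assoc, ← Units.val_mul,
    inv_mul_cancel, Units.val_one, one_mul]

theorem mapMatrix_completionRing_injective :
    Function.Injective
      ((algebraMap P.completionRing P.Completion).mapMatrix (m := Fin 2)) :=
  Matrix.map_injective Subtype.val_injective

theorem mapMatrix_integralOutside_injective :
    Function.Injective (P.integralOutside.subtype.mapMatrix (m := Fin 2)) :=
  Matrix.map_injective Subtype.val_injective

/-- The algebra of all matrices over `A` that preserve the lattice `B 𝒪_∞²`. -/
def endAlgebra : Subalgebra k (Matrix (Fin 2) (Fin 2) K) :=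
  { ((algebraMap P.completionRing P.Completion).mapMatrix (m := Fin 2)).range.comap (P.conj B) ⊓
      (P.integralOutside.subtype.mapMatrix (m := Fin 2)).range with
    algebraMap_mem' := fun c => by
      refine ⟨⟨algebraMap k _ c, (P.conj_algebraMap B c).symm⟩,
        Matrix.scalar (Fin 2) ⟨algebraMap k K c, P.algebraMap_mem_integralOutside c⟩, ?_⟩
      ext i j
      by_cases h : i = j
      · subst h; simp [Matrix.algebraMap_matrix_apply]
      · simp [Matrix.algebraMap_matrix_apply, h] }

variable {P B} in
theorem mem_endAlgebra {M : Matrix (Fin 2) (Fin 2) K} : M ∈ P.endAlgebra B ↔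
    (∃ N, (algebraMap P.completionRing P.Completion).mapMatrix N = P.conj B M) ∧
      ∃ N, P.integralOutside.subtype.mapMatrix N = M := Iff.rfl

/-- The action of the endomorphisms on the lattice, in terms of its basis. -/
def integralConj : P.endAlgebra B →+* Matrix (Fin 2) (Fin 2) P.completionRing where
  toFun M := (mem_endAlgebra.1 M.2).1.choose
  map_one' := P.mapMatrix_completionRing_injective (by
    rw [(mem_endAlgebra.1 (1 : P.endAlgebra B).2).1.choose_spec, map_one]; exact map_one _)
  map_zero' := P.mapMatrix_completionRing_injective (by
    rw [(mem_endAlgebra.1 (0 : P.endAlgebra B).2).1.choose_spec, map_zero]; exact map_zero _)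
  map_add' M N := P.mapMatrix_completionRing_injective (by
    rw [(mem_endAlgebra.1 (M + N).2).1.choose_spec, map_add,
      (mem_endAlgebra.1 M.2).1.choose_spec, (mem_endAlgebra.1 N.2).1.choose_spec]
    exact map_add _ _ _)
  map_mul' M N := P.mapMatrix_completionRing_injective (by
    rw [(mem_endAlgebra.1 (M * N).2).1.choose_spec, map_mul,
      (mem_endAlgebra.1 M.2).1.choose_spec, (mem_endAlgebra.1 N.2).1.choose_spec]
    exact map_mul _ _ _)

theorem mapMatrix_integralConj (M : P.endAlgebra B) :
    (algebraMap P.completionRing P.Completion).mapMatrix (P.integralConj B M) =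
      P.conj B M.1 := (mem_endAlgebra.1 M.2).1.choose_spec

/-- The action of the endomorphisms on the reduction of the lattice. -/
def reductionHom :
    P.endAlgebra B →ₐ[k] Matrix (Fin 2) (Fin 2) (ResidueField P.completionRing) :=
  { (residue P.completionRing).mapMatrix.comp (P.integralConj B) with
    commutes' := fun c => by
      have h : P.integralConj B (algebraMap k _ c) = algebraMap k _ c :=
        P.mapMatrix_completionRing_injective (by
          rw [mapMatrix_integralConj]; exact P.conj_algebraMap B c)
      change (residue P.completionRing).mapMatrix (P.integralConj B (algebraMap k _ c)) = _
      rw [h]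
      ext i j
      by_cases h : i = j
      · subst h; simp [Matrix.algebraMap_matrix_apply]; rfl
      · simp [Matrix.algebraMap_matrix_apply, h] }

theorem reductionHom_apply (M : P.endAlgebra B) :
    P.reductionHom B M = (P.integralConj B M).map (residue P.completionRing) := rfl

/-- Since $M=BNB^{-1}$ with $N$ integral, one denominator clearing all products of entries of $B$
and $B^{-1}$ bounds the poles of all entries of all $M$. -/
theorem finite_endAlgebra (hK : IsFunctionField k K) [Finite k] : Finite (P.endAlgebra B) := by
  obtain ⟨c, hc, hc0, h⟩ := P.exists_mul_mem_completionRing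
    (fun x : (Fin 2 × Fin 2) × (Fin 2 × Fin 2) => B.1 x.1.1 x.1.2 * B⁻¹.1 x.2.1 x.2.2)
  have hT := P.finite_setOf_mul_mem hK hc hc0
  have hmem : ∀ (M : P.endAlgebra B) i j,
      M.1 i j ∈ {x : K | x ∈ P.integralOutside ∧ c * x ∈ P.ring} := by
    intro M i j
    obtain ⟨-, N, hN⟩ := mem_endAlgebra.1 M.2
    refine ⟨hN ▸ (N i j).2, ?_⟩
    have h1 : P.toCompletion.mapMatrix M.1 =
        B.1 * (algebraMap P.completionRing P.Completion).mapMatrix (P.integralConj B M) *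
          B⁻¹.1 := by
      rw [mapMatrix_integralConj, conj_apply, mul_assoc, mul_assoc, mul_assoc, ← Units.val_mul,
        mul_inv_cancel, Units.val_one, mul_one, ← mul_assoc, ← Units.val_mul, mul_inv_cancel,
        Units.val_one, one_mul]
    have h2 : P.toCompletion (M.1 i j) = _ := congrFun (congrFun h1 i) j
    rw [← toCompletion_mem_iff, map_mul, h2, Matrix.mul_apply, Finset.mul_sum]
    refine P.completionRing.toSubring.sum_mem fun b _ => ?_
    rw [Matrix.mul_apply, Finset.sum_mul, Finset.mul_sum]
    refine P.completionRing.toSubring.sum_mem fun a _ => ?_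
    have h3 := P.completionRing.mul_mem _ _ (h ((i, a), (b, j))) (P.integralConj B M a b).2
    have h4 : ∀ x y z w : P.Completion, x * (y * z * w) = x * (y * w) * z := by
      intro x y z w
      ring
    rw [h4]
    exact h3
  have := hT.to_subtype
  refine Finite.of_injective (fun (M : P.endAlgebra B) i j => (⟨M.1 i j, hmem M i j⟩ :
    {x : K | x ∈ P.integralOutside ∧ c * x ∈ P.ring})) fun M N hMN => ?_
  apply Subtype.ext
  ext i j
  exact congrArg Subtype.val (congrFun (congrFun hMN i) j)

/-- Every nonzero vector of `K²` can be scaled to a primitive vector of the lattice. -/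
theorem exists_reduction_eq {w : Fin 2 → K} (hw : w ≠ 0) :
    ∃ a : Fin 2 → ResidueField P.completionRing, a ≠ 0 ∧
      ∃ f : (Fin 2 → K) → Fin 2 → ResidueField P.completionRing,
        ∀ M : P.endAlgebra B, f (M.1 *ᵥ w) = P.reductionHom B M *ᵥ a := by
  classical
  let φ : (Fin 2 → K) → Fin 2 → P.Completion := fun x => B⁻¹.1 *ᵥ fun i => P.toCompletion (x i)
  have hφ : ∀ (M : Matrix (Fin 2) (Fin 2) K) x, φ (M *ᵥ x) = P.conj B M *ᵥ φ x := by
    intro M x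
    have h1 : (fun i => P.toCompletion ((M *ᵥ x) i)) =
        P.toCompletion.mapMatrix M *ᵥ fun i => P.toCompletion (x i) :=
      funext fun i => RingHom.map_mulVec P.toCompletion M x i
    simp only [φ, h1, conj_apply]
    rw [mulVec_mulVec, mulVec_mulVec, mul_assoc _ B.1, ← Units.val_mul, mul_inv_cancel,
      Units.val_one, mul_one]
  have hφw : φ w ≠ 0 := by
    intro h
    apply hw
    have h1 : B.1 *ᵥ φ w = fun i => P.toCompletion (w i) := GL_mulVec_inv_mulVec B _
    rw [h, mulVec_zero] at h1
    ext i
    exact P.toCompletion.injective ((congrFun h1 i).symm.trans (map_zero _).symm)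
  -- Dividing by a coordinate of largest valuation makes the vector integral with a coordinate equal
  -- to $1$, so its reduction is nonzero.
  obtain ⟨i, hi⟩ := Finite.exists_max fun i =>
    (Valued.v (φ w i) : P.ring.ValueGroup)
  have hi0 : φ w i ≠ 0 := by
    intro h
    apply hφw
    ext j
    have := hi j
    rw [h, map_zero, le_zero_iff, map_eq_zero] at this
    exact this
  have hmem : ∀ j, (φ w i)⁻¹ * φ w j ∈ P.completionRing := by
    intro j
    rw [mem_completionRing_iff, map_mul, map_inv₀]
    rw [inv_mul_le_iff₀ (zero_lt_iff.2 ((map_ne_zero _).2 hi0)), mul_one]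
    exact hi j
  let y : Fin 2 → P.completionRing := fun j => ⟨_, hmem j⟩
  have hy : coordMap P.completionRing P.Completion y = (φ w i)⁻¹ • φ w := rfl
  have hyi : y i = 1 := Subtype.ext (inv_mul_cancel₀ hi0)
  -- Scale by the same factor and reduce. The default $0$ concerns vectors outside the lattice,
  -- which the orbit of $w$ never meets.
  let f : (Fin 2 → K) → Fin 2 → ResidueField P.completionRing := fun x =>
    if h : ∃ z, coordMap P.completionRing P.Completion z = (φ w i)⁻¹ • φ x then
      reduction _ h.choose else 0
  have hf : ∀ x z, coordMap P.completionRing P.Completion z = (φ w i)⁻¹ • φ x →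
      f x = reduction _ z := by
    intro x z hz
    have h : ∃ z, coordMap P.completionRing P.Completion z = (φ w i)⁻¹ • φ x := ⟨z, hz⟩
    simp only [f, h, dif_pos]
    rw [coordMap_injective (h.choose_spec.trans hz.symm)]
  refine ⟨reduction _ y, ?_, f, fun M => ?_⟩
  · intro h
    have := congrFun h i
    rw [reduction_apply, hyi, map_one] at this
    exact one_ne_zero this
  · rw [hf _ (P.integralConj B M *ᵥ y), reduction_mulVec, reductionHom_apply]
    rw [coordMap_mulVec, hy, hφ, mulVec_smul]
    exact congrArg (fun X : Matrix (Fin 2) (Fin 2) P.Completion => (φ w i)⁻¹ • X *ᵥ φ w)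
      (P.mapMatrix_integralConj B M)

end Conj

/-! ### Stabilizers, neighbours and isolated vertices -/

section Stabilizer

/-- The matrix over `K` of an element of `GL₂(A)`. -/
def modularMatrix : P.modularGroup →* Matrix (Fin 2) (Fin 2) K :=
  (P.integralOutside.subtype.mapMatrix (m := Fin 2)).toMonoidHom.comp (Units.coeHom _)

theorem modularMatrix_apply (g : P.modularGroup) :
    P.modularMatrix g = g.1.map P.integralOutside.subtype := rfl

theorem modularMatrix_injective : Function.Injective P.modularMatrix := fun _ _ h =>
  Units.ext (P.mapMatrix_integralOutside_injective h)

theorem smul_treeVertex (g : P.modularGroup) (v : P.TreeVertex) :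
    g • v = P.modularGroupToGL g • v := rfl

variable (B : GeneralLinearGroup (Fin 2) P.Completion)

theorem conj_modularMatrix (g : P.modularGroup) :
    P.conj B (P.modularMatrix g) = (B⁻¹ * P.modularGroupToGL g * B).1 := rfl

/-- The determinant is a unit of $A$, hence a nonzero constant, and constants are units of $\mathcal
O_\infty$. -/
theorem exists_det_conj_eq (hK : IsFunctionField k K) (g : P.modularGroup) :
    ∃ e : P.completionRing, IsUnit e ∧
      (B⁻¹ * P.modularGroupToGL g * B).1.det = algebraMap _ P.Completion e := by
  have h1 : (g.1.det : K) * (g⁻¹.1.det : K) = 1 := by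
    have : g.1.det * g⁻¹.1.det = 1 := by
      rw [← det_mul, ← Units.val_mul, mul_inv_cancel, Units.val_one, det_one]
    exact congrArg Subtype.val this
  obtain ⟨c, hc0, hc⟩ := P.exists_eq_of_mul_eq_one hK g.1.det.2 g⁻¹.1.det.2 h1
  refine ⟨algebraMap k _ c, (IsUnit.mk0 c hc0).map _, ?_⟩
  have h2 : (P.modularGroupToGL g).1.det = P.toCompletion (algebraMap k K c) := by
    rw [hc]
    exact (RingHom.map_det (P.toCompletion.comp P.integralOutside.subtype) g.1).symm
  have h3 : (B⁻¹ * P.modularGroupToGL g * B).1.det = (P.modularGroupToGL g).1.det := by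
    rw [Units.val_mul, Units.val_mul, det_mul, det_mul, mul_right_comm, ← det_mul,
      ← Units.val_mul, inv_mul_cancel, Units.val_one, det_one, one_mul]
  rw [h3, h2]
  rfl

theorem smul_eq_conj_smul (g : P.modularGroup) (x : P.TreeVertex) :
    g • (B • x) = B • ((B⁻¹ * P.modularGroupToGL g * B) • x) := by
  rw [smul_treeVertex, smul_smul, smul_smul, ← mul_assoc, ← mul_assoc, mul_inv_cancel, one_mul]

theorem reductionHom_mulVec_ne_zero (u : (P.endAlgebra B)ˣ)
    {a : Fin 2 → ResidueField P.completionRing} (ha : a ≠ 0) :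
    P.reductionHom B (u : P.endAlgebra B) *ᵥ a ≠ 0 := by
  intro h
  apply ha
  have : P.reductionHom B (↑u⁻¹ : P.endAlgebra B) *ᵥ
      (P.reductionHom B (u : P.endAlgebra B) *ᵥ a) = a := by
    rw [mulVec_mulVec, ← map_mul, Units.inv_mul, map_one, one_mulVec]
  rw [← this, h, mulVec_zero]

variable [IsDiscreteValuationRing P.completionRing]

/-- The vertex of the lattice `B 𝒪_∞²`. -/
def vertexOf : P.TreeVertex := B • Vertex.mk (stdLattice P.completionRing P.Completion)

theorem exists_vertexOf_eq (v : P.TreeVertex) : ∃ B, P.vertexOf B = v := by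
  obtain ⟨L, rfl⟩ := v.exists_mk
  obtain ⟨B, rfl⟩ := exists_smul_stdLattice_eq L
  exact ⟨B, rfl⟩

/-- The neighbour of `vertexOf B` in a given direction. -/
def neighbour (u : Fin 2 → ResidueField P.completionRing) : P.TreeVertex :=
  B • Vertex.mk (lineLattice P.Completion u)

theorem adj_vertexOf_iff {w : P.TreeVertex} :
    (tree P.completionRing P.Completion).Adj (P.vertexOf B) w ↔
      ∃ u : Fin 2 → ResidueField P.completionRing, u ≠ 0 ∧ w = P.neighbour B u := by
  rw [← tree_adj_smul_iff B⁻¹, vertexOf, inv_smul_smul, adj_stdLattice_iff]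
  simp only [neighbour, inv_smul_eq_iff]

theorem mem_stabilizer_iff_exists (hK : IsFunctionField k K) {g : P.modularGroup} :
    g ∈ MulAction.stabilizer P.modularGroup (P.vertexOf B) ↔
      ∃ γ : GeneralLinearGroup (Fin 2) P.completionRing,
        GeneralLinearGroup.map (algebraMap _ P.Completion) γ =
          B⁻¹ * P.modularGroupToGL g * B := by
  rw [MulAction.mem_stabilizer_iff, vertexOf, smul_eq_conj_smul, smul_left_cancel_iff]
  constructor
  · intro h
    obtain ⟨e, he, hdet⟩ := P.exists_det_conj_eq B hK g
    exact exists_glMap_eq_of_smul_eq (smul_stdLattice_eq_of_smul_vertex he hdet h)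
  · rintro ⟨γ, hγ⟩
    rw [← hγ, Vertex.smul_mk, glMap_smul_stdLattice]

theorem modularMatrix_mem_endAlgebra (hK : IsFunctionField k K) {g : P.modularGroup}
    (hg : g ∈ MulAction.stabilizer P.modularGroup (P.vertexOf B)) :
    P.modularMatrix g ∈ P.endAlgebra B := by
  obtain ⟨γ, hγ⟩ := (P.mem_stabilizer_iff_exists B hK).1 hg
  exact mem_endAlgebra.2 ⟨⟨γ.1, congrArg Units.val hγ⟩, ⟨g.1, rfl⟩⟩

/-- The stabilizer of a vertex is the unit group of a finite algebra. -/
def stabilizerHom (hK : IsFunctionField k K) :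
    MulAction.stabilizer P.modularGroup (P.vertexOf B) →* (P.endAlgebra B)ˣ :=
  MonoidHom.toHomUnits
    { toFun := fun g => ⟨P.modularMatrix g, P.modularMatrix_mem_endAlgebra B hK g.2⟩
      map_one' := Subtype.ext (map_one _)
      map_mul' := fun g h => Subtype.ext (map_mul _ g.1 h.1) }

theorem stabilizerHom_bijective (hK : IsFunctionField k K) :
    Function.Bijective (P.stabilizerHom B hK) := by
  constructor
  · intro g h hgh
    exact Subtype.ext (P.modularMatrix_injective
      (congrArg (fun u : (P.endAlgebra B)ˣ => u.1.1) hgh))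
  · intro u
    obtain ⟨-, M, hM⟩ := mem_endAlgebra.1 u.1.2
    obtain ⟨-, N, hN⟩ := mem_endAlgebra.1 (u⁻¹).1.2
    have hMN : M * N = 1 := P.mapMatrix_integralOutside_injective (by
      rw [map_mul, hM, hN, map_one]
      exact congrArg Subtype.val u.mul_inv)
    let g : P.modularGroup := ⟨M, N, hMN, mul_eq_one_comm.1 hMN⟩
    let γ : GeneralLinearGroup (Fin 2) P.completionRing :=
      Units.map (P.integralConj B : _ →* _) u
    have hg : g ∈ MulAction.stabilizer P.modularGroup (P.vertexOf B) := by
      refine (P.mem_stabilizer_iff_exists B hK).2 ⟨γ, Units.ext ?_⟩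
      rw [← conj_modularMatrix]
      refine (P.mapMatrix_integralConj B u.1).trans ?_
      rw [← hM]
      rfl
    exact ⟨⟨g, hg⟩, Units.ext (Subtype.ext hM)⟩

/-- The stabilizer of a vertex is the unit group of a finite algebra. -/
def stabilizerEquiv (hK : IsFunctionField k K) :
    MulAction.stabilizer P.modularGroup (P.vertexOf B) ≃* (P.endAlgebra B)ˣ :=
  MulEquiv.ofBijective _ (P.stabilizerHom_bijective B hK)

theorem stabilizer_smul_neighbour (hK : IsFunctionField k K)
    (g : MulAction.stabilizer P.modularGroup (P.vertexOf B))
    (u : Fin 2 → ResidueField P.completionRing) :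
    g.1 • P.neighbour B u =
      P.neighbour B (P.reductionHom B (P.stabilizerEquiv B hK g : P.endAlgebra B) *ᵥ u) := by
  obtain ⟨γ, hγ⟩ := (P.mem_stabilizer_iff_exists B hK).1 g.2
  have h : P.integralConj B (P.stabilizerEquiv B hK g : P.endAlgebra B) = γ.1 :=
    P.mapMatrix_completionRing_injective
      ((P.mapMatrix_integralConj B _).trans (congrArg Units.val hγ).symm)
  rw [neighbour, smul_eq_conj_smul, ← hγ, Vertex.smul_mk, glMap_smul_lineLattice, neighbour,
    reductionHom_apply, h]

/-- Neighbours of the vertex correspond to lines in the reduction, and the stabilizer permutes them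
through `reductionHom`. The unit determinant excludes moving the vertex to a neighbour. -/
theorem isIsolated_iff_isTransitiveOnLines (hK : IsFunctionField k K) :
    IsIsolated P.quotientTree (Quotient.mk _ (P.vertexOf B)) ↔
      IsTransitiveOnLines (P.reductionHom B) := by
  rw [quotientTree, isIsolated_quotientGraph_iff]
  · constructor
    · intro h a b ha hb
      obtain ⟨g, hg, hgab⟩ := h _ _ ((P.adj_vertexOf_iff B).2 ⟨a, ha, rfl⟩)
        ((P.adj_vertexOf_iff B).2 ⟨b, hb, rfl⟩)
      refine ⟨P.stabilizerEquiv B hK ⟨g, hg⟩, ?_⟩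
      have h1 := P.stabilizer_smul_neighbour B hK ⟨g, hg⟩ a
      rw [hgab, neighbour, neighbour, smul_left_cancel_iff] at h1
      have ha' := P.reductionHom_mulVec_ne_zero B (P.stabilizerEquiv B hK ⟨g, hg⟩) ha
      exact (lineLattice_eq_lineLattice_iff ha').1
        (mk_lineLattice_eq_mk_lineLattice ha' hb h1.symm)
    · rintro h w w' hw hw'
      obtain ⟨a, ha, rfl⟩ := (P.adj_vertexOf_iff B).1 hw
      obtain ⟨b, hb, rfl⟩ := (P.adj_vertexOf_iff B).1 hw'
      obtain ⟨u, s, hs⟩ := h a b ha hb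
      obtain ⟨g, rfl⟩ := (P.stabilizerEquiv B hK).surjective u
      refine ⟨g, g.2, ?_⟩
      rw [stabilizer_smul_neighbour P B hK, neighbour, neighbour]
      rw [(lineLattice_eq_lineLattice_iff (P.reductionHom_mulVec_ne_zero B _ ha)).2 ⟨s, hs⟩]
  · intro g v w h
    exact tree_adj_smul _ h
  · intro g h
    obtain ⟨u, hu, hg⟩ := (P.adj_vertexOf_iff B).1 h
    obtain ⟨e, he, hdet⟩ := P.exists_det_conj_eq B hK g
    rw [vertexOf, smul_eq_conj_smul, neighbour, smul_left_cancel_iff] at hg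
    exact smul_mk_stdLattice_ne he hdet hu hg
  · exact ⟨_, (P.adj_vertexOf_iff B).2 ⟨fun _ => 1, fun h => one_ne_zero (congrFun h 0), rfl⟩⟩

omit [IsDiscreteValuationRing P.completionRing] in
theorem aeval_charpoly_eq_zero_iff (g : P.modularGroup) (c : k) :
    Polynomial.aeval (algebraMap k (AlgebraicClosure K) c) (P.charpoly g) = 0 ↔
      (P.modularMatrix g + algebraMap k K (-c) • (1 : Matrix (Fin 2) (Fin 2) K)).det = 0 := by
  rw [IsScalarTower.algebraMap_apply k K (AlgebraicClosure K), Polynomial.aeval_algebraMap_apply,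
    FaithfulSMul.algebraMap_eq_zero_iff, Polynomial.coe_aeval_eq_eval, charpoly, eval_charpoly,
    ← modularMatrix_apply, ← neg_sub, det_neg, Fintype.card_fin, neg_one_sq, one_mul,
    map_neg (algebraMap k K), neg_smul, ← sub_eq_add_neg, smul_one_eq_diagonal, scalar_apply]

theorem hasNonsplit_endAlgebra_iff (hK : IsFunctionField k K) [Finite k] :
    HasNonsplit (P.endAlgebra B) ↔
      ∃ M ∈ MulAction.stabilizer P.modularGroup (P.vertexOf B), ∀ μ : AlgebraicClosure K,
        Polynomial.aeval μ (P.charpoly M) = 0 →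
          μ ∉ (algebraMap k (AlgebraicClosure K)).range := by
  have hfin := P.finite_endAlgebra B hK
  constructor
  · rintro ⟨M, hM, h⟩
    -- The case $c=0$ says that $M$ is invertible, so a nonsplit element of the algebra already
    -- comes from the stabilizer.
    obtain ⟨u, hu⟩ := mem_isUnit hK.mem_range_of_isAlgebraic hM (by simpa using h 0)
    obtain ⟨g, rfl⟩ := (P.stabilizerEquiv B hK).surjective u
    refine ⟨g, g.2, ?_⟩
    rintro _ hμ ⟨c, rfl⟩
    refine h (-c) ?_
    rw [aeval_charpoly_eq_zero_iff] at hμ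
    have : P.modularMatrix g = M := congrArg Subtype.val hu
    rwa [this] at hμ
  · rintro ⟨g, hg, h⟩
    refine ⟨_, P.modularMatrix_mem_endAlgebra B hK hg, fun c hc => ?_⟩
    refine h (algebraMap k _ (-c)) ?_ ⟨-c, rfl⟩
    rwa [aeval_charpoly_eq_zero_iff, neg_neg]

end Stabilizer

end Place

end DrinfeldModular
end

theorem theorem4p1 {k K : Type*} [Field k] [Finite k] [Field K] [Algebra k K]
    (hK : DrinfeldModular.IsFunctionField k K) (P : DrinfeldModular.Place k K)
    (q : ℕ) (hq : Nat.card k = q) (v : P.TreeVertex) :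
    Finite (MulAction.stabilizer P.modularGroup v) ∧
    List.TFAE [
      q ^ 2 - 1 ∣ Nat.card (MulAction.stabilizer P.modularGroup v),
      ∃ M ∈ MulAction.stabilizer P.modularGroup v,
        ∀ μ : AlgebraicClosure K,
          Polynomial.aeval μ (P.charpoly M) = 0 → μ ∉ (algebraMap k (AlgebraicClosure K)).range,
      ∃ C : Subgroup P.modularGroup, C ≤ MulAction.stabilizer P.modularGroup v ∧
        IsCyclic C ∧ Nat.card C = q ^ 2 - 1] ∧
    (DrinfeldModular.IsIsolated P.quotientTree (Quotient.mk _ v) ↔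
      P.degree = 1 ∧ q ^ 2 - 1 ∣ Nat.card (MulAction.stabilizer P.modularGroup v)) := by
  subst hq
  have := P.isDiscreteValuationRing hK
  have := P.isDiscreteValuationRing_completionRing
  have := P.finite_residueField_completionRing hK
  obtain ⟨B, rfl⟩ := P.exists_vertexOf_eq v
  have := P.finite_endAlgebra B hK
  have hk := hK.mem_range_of_isAlgebraic
  let e := P.stabilizerEquiv B hK
  have hcard := Nat.card_congr e.toEquiv
  refine ⟨Finite.of_equiv _ e.toEquiv.symm, ?_, ?_⟩
  · tfae_have 1 → 2 := fun h => (P.hasNonsplit_endAlgebra_iff B hK).1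
      (DrinfeldModular.hasNonsplit_of_dvd_card_units hk (hcard ▸ h))
    tfae_have 2 → 3 := fun h => by
      obtain ⟨C, hC, hCc⟩ := DrinfeldModular.exists_isCyclic_of_hasNonsplit hk
        ((P.hasNonsplit_endAlgebra_iff B hK).2 h)
      let f := (Subgroup.subtype _).comp e.symm.toMonoidHom
      have hf : Function.Injective f := Subtype.val_injective.comp e.symm.injective
      refine ⟨C.map f, ?_, ?_, ?_⟩
      · rintro _ ⟨u, -, rfl⟩
        exact (e.symm u).2
      · exact isCyclic_of_surjective _ (C.equivMapOfInjective f hf).surjective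
      · rw [← hCc]
        exact (Nat.card_congr (C.equivMapOfInjective f hf).toEquiv).symm
    tfae_have 3 → 1 := by
      rintro ⟨C, hC, -, hCc⟩
      rw [← hCc]
      exact Subgroup.card_dvd_of_le hC
    tfae_finish
  · rw [P.isIsolated_iff_isTransitiveOnLines B hK, hcard,
      DrinfeldModular.isTransitiveOnLines_iff hk fun w hw => P.exists_reduction_eq B hw,
      P.finrank_residueField_completionRing]
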